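/- Let $C$ be a field of characteristic $0$, let $(D,\leqslant)$ be a non-empty directed set, and let $(\Gamma_d)_{d\in D}$ be a system, directed for inclusion, of non-trivial (totally) ordered abelian groups, with union (direct limit) $\Gamma$. Let $\mathbb{S}_d=C((\Gamma_d))$ be the field of Hahn series with well-ordered support in $\Gamma_d$, and let $\mathbb{S}=\bigcup_{d\in D}\mathbb{S}_d$, with valuation $v(f)=\min\operatorname{supp} f$, $v(0)=+\infty$. Write $f\preccurlyeq g$ if $v(f)\geqslant v(g)$, $f\prec g$ if $v(f)>v(g)$, and $f\sim g$ if $v(f-g)>v(f)$. A family in $\mathbb{S}$ is summable if it takes its values in some $\mathbb{S}_{d}$ and is summable there as a family of Hahn series. A $C$-linear map $\mathbb{S}\to\mathbb{S}$ is *strongly linear* if it commutes with sums of summable families; it is *regular* if for every $d\in D$ it maps $\mathbb{S}_d$ into $\mathbb{S}_d$ and restricts to a strongly linear map of $\mathbb{S}_d$; it is *contracting* if it maps every $f\neq 0$ to an element $\prec f$. Let $\partial:f\mapsto f'$ be a regular $C$-linear derivation on $\mathbb{S}$ with kernel $C$, and write $f^\dagger=f'/f$ for $f\ne0$. Assume that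 $(\mathbb{S},\preccurlyeq,\partial)$ is an H-asymptotic field: for all non-zero $f,g\prec 1$ we have $f\prec g\Leftrightarrow f'\prec g'$, and $f\prec g\Rightarrow f^\dagger\succcurlyeq g^\dagger$. There are then well-defined maps $'$ and $^\dagger$ from $\Gamma\setminus\{0\}$ to $\Gamma$ given by $v(a)'=v(a')$ and $v(a)^\dagger=v(a^\dagger)$. Set $\Psi=\{\gamma^\dagger:\gamma\in\Gamma,\ \gamma>0\}$, and let $\operatorname{Cont}(\partial)$ be the set of $f\in\mathbb{S}$ such that $f\partial$ is contracting. A pseudo-gap is an element of $\Gamma$ that is not of the form $\alpha'$ with $\alpha\in\Gamma\setminus\{0\}$. Assume that $\mathbb{S}$ has regular asymptotic integration, that is: 1. for every non-zero $f\in\mathbb{S}$ there is $A\in\mathbb{S}$ with $A'\sim f$; and 2. for every $d\in D$ there is $d_1\geqslant d$ in $D$ such that for every non-zero $f\in\mathbb{S}_d$ whose valuation is not a pseudo-gap, there is a term $\tau=c\,t^{\gamma}$ with $c\in C$ and $\gamma\in\Gamma_{d_1}$ (where $t^\gamma$ is the monomial of valuation $\gamma$) such that $\tau'\sim f$ and $\tau'\in\mathbb{S}_d$.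 Let $f,g\in\operatorname{Cont}(\partial)\setminus\{0\}$ be such that $f\sim g$ and $v\left(\frac{f-g}{g^2}\right)>(-v(g)-\Psi)'$, that is, $v\left(\frac{f-g}{g^2}\right)>(-v(g)-\psi)'$ for all $\psi\in\Psi$. Then there are an $h\in\operatorname{Cont}(\partial)$ and a $C$-algebra automorphism $\sigma$ of $\mathbb{S}$ such that $\sigma=\exp(h\partial)$, that is, for each $x\in\mathbb{S}$ the family $\left(\frac{1}{n!}(h\partial)^n(x)\right)_{n\in\mathbb{N}}$ is summable with sum $\sigma(x)$, such that $\sigma$ and $\sigma^{-1}$ are strongly linear, and such that $$\sigma\circ(g\partial)\circ\sigma^{-1}=f\partial .$$ -/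

import Mathlib

namespace HahnConj

universe u v w

set_option synthInstance.maxHeartbeats 400000 in
/-- The canonical copy of the Hahn field `C((H))` inside `C((Γ))`, for a subgroup `H` of `Γ`:
the image of the inclusion `C((H)) → C((Γ))`. See `mem_hahnSub_iff`. -/
noncomputable def hahnSub {Γ : Type u} [AddCommGroup Γ] [LinearOrder Γ] [IsOrderedAddMonoid Γ]
    (C : Type v) [Field C] (H : AddSubgroup Γ) : IntermediateField C (HahnSeries Γ C) :=
  (HahnSeries.embDomainAlgHom (R := C) (A := C) H.subtype H.subtype_injective
    (fun _ _ => Iff.rfl)).fieldRange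

theorem mem_hahnSub_iff {Γ : Type u} [AddCommGroup Γ] [LinearOrder Γ] [IsOrderedAddMonoid Γ]
    {C : Type v} [Field C] {H : AddSubgroup Γ} {x : HahnSeries Γ C} :
    x ∈ hahnSub C H ↔ ∀ γ, x.coeff γ ≠ 0 → γ ∈ H := by
  let e : H ↪o Γ := ⟨⟨H.subtype, H.subtype_injective⟩, Iff.rfl⟩
  constructor
  · rintro ⟨y, rfl⟩ γ hγ
    by_contra hn
    apply hγ
    exact HahnSeries.embDomain_of_notMem_range (f := e)
      (by rintro ⟨z, rfl⟩; exact hn z.2)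
  · intro h
    refine ⟨⟨fun z => x.coeff z, ?_⟩, ?_⟩
    · have hx : (x.support).IsWF := x.isWF_support
      have : (Function.support fun z : H => x.coeff z).IsWF := by
        rw [Set.isWF_iff_no_descending_seq] at hx ⊢
        intro f hf hmem
        exact hx (fun n => (f n : Γ)) (fun a b hab => hf hab) (fun n => hmem n)
      exact this.isPWO
    · ext γ
      by_cases hγ : γ ∈ H
      · exact HahnSeries.embDomain_coeff (f := e) (a := ⟨γ, hγ⟩)
      · have h0 : x.coeff γ = 0 := by
          by_contra hc
          exact hγ (h γ hc)
        rw [h0]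
        exact HahnSeries.embDomain_of_notMem_range (f := e)
          (by rintro ⟨z, rfl⟩; exact hγ z.2)

theorem hahnSub_mono {Γ : Type u} [AddCommGroup Γ] [LinearOrder Γ] [IsOrderedAddMonoid Γ]
    {C : Type v} [Field C] {H K : AddSubgroup Γ} (h : H ≤ K) : hahnSub C H ≤ hahnSub C K :=
  fun _ hx => mem_hahnSub_iff.2 fun γ hγ => h (mem_hahnSub_iff.1 hx γ hγ)

section

variable {Γ : Type u} [AddCommGroup Γ] [LinearOrder Γ] [IsOrderedAddMonoid Γ]
variable (C : Type v) [Field C] {D : Type w} (G : D → AddSubgroup Γ)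

/-- The direct limit `𝕊` of the Hahn fields `𝕊_d = C((G d))`. For a directed family `G` it is
their union inside `C((Γ))`, see `mem_hahnLimit_iff`. -/
noncomputable def hahnLimit : IntermediateField C (HahnSeries Γ C) := ⨆ d, hahnSub C (G d)

theorem mem_hahnLimit_iff [Preorder D] [IsDirectedOrder D] [Nonempty D] (hG : Monotone G)
    {x : HahnSeries Γ C} : x ∈ hahnLimit C G ↔ ∃ d, x ∈ hahnSub C (G d) := by
  have hm : Monotone fun d => hahnSub C (G d) := fun _ _ h => hahnSub_mono (hG h)
  have := IntermediateField.coe_iSup_of_directed hm.directed_le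
  rw [← SetLike.mem_coe, hahnLimit, this, Set.mem_iUnion]
  rfl

/-- The direct limit `𝕊` as a type, with its structure of field extension of `C`. -/
def Lim : Type (max u v) := hahnLimit C G

noncomputable instance : Field (Lim C G) := inferInstanceAs (Field (hahnLimit C G))

set_option synthInstance.maxHeartbeats 400000 in
noncomputable instance : Algebra C (Lim C G) := inferInstanceAs (Algebra C (hahnLimit C G))

variable {C} {G}

set_option synthInstance.maxHeartbeats 400000 in
/-- The inclusion `𝕊 → C((Γ))`. -/
noncomputable def Lim.series : Lim C G →ₐ[C] HahnSeries Γ C := (hahnLimit C G).val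

/-- The valuation `v(x) = min supp x`, with `v(0) = ⊤`. -/
noncomputable def val (x : Lim C G) : WithTop Γ := (Lim.series x).orderTop

/-- `x ≺ y`. -/
def Prec (x y : Lim C G) : Prop := val y < val x

/-- `x ∼ y`. -/
def Sim (x y : Lim C G) : Prop := val x < val (x - y)

/-- `x ∈ 𝕊_d`. -/
def InStage (d : D) (x : Lim C G) : Prop := Lim.series x ∈ hahnSub C (G d)

/-- The family `F` in `𝕊` is summable, with sum `x`: it takes its values in one `𝕊_d`, it is
summable as a family of Hahn series, and its sum is `x`. -/
def HasStrongSum {ι : Type*} (F : ι → Lim C G) (x : Lim C G) : Prop :=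
  (∃ d, ∀ i, InStage d (F i)) ∧
    ∃ s : HahnSeries.SummableFamily Γ C ι,
      (∀ i, s i = Lim.series (F i)) ∧ s.hsum = Lim.series x

/-- `φ` commutes with infinite sums. (Index types in the universe of `Γ` suffice: a summable family
has at most `max |Γ| ℵ₀` nonzero members.) -/
def IsStronglyLinear (φ : Lim C G →ₗ[C] Lim C G) : Prop :=
  ∀ (ι : Type u) (F : ι → Lim C G) (x : Lim C G),
    HasStrongSum F x → HasStrongSum (fun i => φ (F i)) (φ x)

/-- `φ` is regular: it maps each `𝕊_d` to itself, by a strongly linear map. -/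
def IsRegular (φ : Lim C G →ₗ[C] Lim C G) : Prop :=
  ∀ d : D, (∀ x, InStage d x → InStage d (φ x)) ∧
    ∀ (ι : Type u) (F : ι → Lim C G) (x : Lim C G), (∀ i, InStage d (F i)) →
      HasStrongSum F x → HasStrongSum (fun i => φ (F i)) (φ x)

/-- `φ` is contracting: `φ x ≺ x` for all `x ≠ 0`. -/
def IsContracting (φ : Lim C G →ₗ[C] Lim C G) : Prop :=
  ∀ x, x ≠ 0 → Prec (φ x) x

/-- The contractive hull `Cont(∂)`. -/
def Cont (der : Derivation C (Lim C G) (Lim C G)) : Set (Lim C G) :=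
  {f | IsContracting (f • der).toLinearMap}

/-- `σ = exp φ`: for all `x`, the family `(φⁿ x / n!)` is summable with sum `σ x`. -/
def IsExp (φ σ : Lim C G →ₗ[C] Lim C G) : Prop :=
  ∀ x, HasStrongSum (fun n : ℕ => ((n.factorial : C)⁻¹) • (φ ^ n) x) (σ x)

/-- `(𝕊, ≼, ∂)` is an H-asymptotic field. -/
def IsHAsymptotic (der : Derivation C (Lim C G) (Lim C G)) : Prop :=
  ∀ f g : Lim C G, f ≠ 0 → g ≠ 0 → Prec f 1 → Prec g 1 →
    (Prec f g ↔ Prec (der f) (der g)) ∧ (Prec f g → val (der f / f) ≤ val (der g / g))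

/-- The graph of the map `′ : Γ ∖ {0} → Γ, v(a) ↦ v(a′)`: this says `β = α′`. -/
def IsPrimeValue (der : Derivation C (Lim C G) (Lim C G)) (α β : Γ) : Prop :=
  α ≠ 0 ∧ ∃ a : Lim C G, val a = (α : WithTop Γ) ∧ val (der a) = (β : WithTop Γ)

/-- The graph of the map `† : Γ ∖ {0} → Γ, v(a) ↦ v(a′ / a)`: this says `β = α†`. -/
def IsDaggerValue (der : Derivation C (Lim C G) (Lim C G)) (α β : Γ) : Prop :=
  α ≠ 0 ∧ ∃ a : Lim C G, val a = (α : WithTop Γ) ∧ val (der a / a) = (β : WithTop Γ)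

/-- The set `Ψ = {γ† | γ > 0}`. -/
def psiSet (der : Derivation C (Lim C G) (Lim C G)) : Set Γ :=
  {ψ | ∃ γ : Γ, 0 < γ ∧ IsDaggerValue der γ ψ}

/-- `γ` is a pseudo-gap: it is not in the image of `′`. -/
def IsPseudoGap (der : Derivation C (Lim C G) (Lim C G)) (γ : Γ) : Prop :=
  ¬ ∃ α, IsPrimeValue der α γ

/-- Every nonzero `f` has an asymptotic integral `A`, that is, `A′ ∼ f`. -/
def ClosedUnderAsympIntegration (der : Derivation C (Lim C G) (Lim C G)) : Prop :=
  ∀ f : Lim C G, f ≠ 0 → ∃ A : Lim C G, Sim (der A) f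

/-- `τ` is a term of `𝕊_d`, that is, `τ = c t^γ` with `c ∈ C` and `γ ∈ G d`. -/
def IsTerm (d : D) (τ : Lim C G) : Prop :=
  ∃ γ ∈ G d, ∃ c : C, Lim.series τ = HahnSeries.single γ c

/-- Asymptotic integration is regular on `𝕊`: for each `d` there is `d₁ ≥ d` such that each nonzero
`f ∈ 𝕊_d` whose valuation is not the pseudo-gap has `τ′ ∼ f` for a term `τ` of `𝕊_{d₁}` with
`τ′ ∈ 𝕊_d`. -/
def AsympIntegrationRegular [Preorder D]
    (der : Derivation C (Lim C G) (Lim C G)) : Prop :=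
  ∀ d : D, ∃ d₁ : D, d ≤ d₁ ∧ ∀ f : Lim C G, f ≠ 0 → InStage d f →
    (∀ γ : Γ, val f = (γ : WithTop Γ) → ¬ IsPseudoGap der γ) →
    ∃ τ : Lim C G, IsTerm d₁ τ ∧ Sim (der τ) f ∧ InStage d (der τ)

/-- `(𝕊, ≼, ∂)` has regular asymptotic integration. -/
def HasRegularAsympIntegration [Preorder D]
    (der : Derivation C (Lim C G) (Lim C G)) : Prop :=
  ClosedUnderAsympIntegration der ∧ AsympIntegrationRegular der

end

end HahnConj

/-!
The proof works inside the Lie algebra of derivations `w g ∂`, `w ∈ 𝕊`. Since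
`[u g ∂, w g ∂] = (u g w′ - w g u′) g ∂ = (adMap u w) g ∂`, conjugating `g ∂` by `σ = exp (u g ∂)`
gives `E(u) g ∂`, where `E(u) = ∑ (adMap u)ⁿ 1 / n!` (`expAd`, `IsExp.map_mul_der`). So it suffices
to solve `E(u) = f / g` with `u g ∂` contracting, and to take `h = u g`.

*Exponentials.* Both exponentials exist because the orbit of a summable family under a contracting
strongly linear operator is summable (`SummableAt.orbit`). Summable families indexed by `κ` are Hahn
series with coefficients in `κ →₀ C`, Hahn series are spherically complete, and the orbit is the
fixed point of a contracting map on such series. The same fixed point principle inverts `exp φ` on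
summable families, which makes the inverse of `exp φ` strongly linear. That `σ` is multiplicative,
and the conjugation formula, are Cauchy products applied to a general Leibniz rule.

*The equation.* For admissible `u₁, u₂` with difference `Δ`, the difference `E(u₁) - E(u₂)` is
`- g Δ′` up to something smaller (`val_lt_expAd_sub`), so `E` distorts distances monotonically, and
spherical completeness provides a best approximate solution `u` in each stage `𝕊_d`
(`exists_max_val_sub_expAd`). The condition on `(f - g) / g²` ensures that a further correction `Δ`
would keep `u g ∂` contracting (`mem_cont_of_le`); hence the remainder `f / g - E(u)` is zero or
has valuation `v(g) + s` where `s` is not of the form `γ′` with `γ` in the value group `G d` of the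
stage (`prime_ne_of_max`).

*Changing the stage.* In the second case, regularity of asymptotic integration yields a term `Δ` of
a later stage `𝕊_e`, with `Δ′ ∈ 𝕊_d`, for which `- g Δ′` is asymptotic to the remainder. One such
step is enough. By the theory of asymptotic couples of H-type, the exceptional `s` is an upper bound
of `ψ` on `G d` (`IsHCouple.psi_le_of_forall_ne`), `v(Δ)` is negligible with respect to the positive
elements of `G d`, and consequently the new remainder has valuation at least `v(g) + α′` for some
positive `α ∈ G e` (`isDeep_expAd_sub`). All elements of `G e` above `α′` are of the form `γ′` with
`γ ∈ G e` (`IsHCouple.exists_prime_eq_of_le`), so the best approximate solution in `𝕊_e` is exact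
(`exists_expAd_eq`).
-/

namespace HahnConj

universe u v w

/-! ### Pseudo-limits and a maximality principle for ultrametric maps -/

/-- A form of spherical completeness: nested balls in `HahnSeries Γ A` have a common point, whose
support can be taken in any set that contains the supports of the centres. -/
theorem exists_pseudoLimit {Γ A : Type*} [LinearOrder Γ] [AddCommGroup A]
    (T : Set Γ) (S : Set (HahnSeries Γ A)) (hT : ∀ a ∈ S, a.support ⊆ T)
    (r : HahnSeries Γ A → WithTop Γ)
    (hr : ∀ a ∈ S, ∀ b ∈ S, min (r a) (r b) ≤ (a - b).orderTop) :
    ∃ x : HahnSeries Γ A, x.support ⊆ T ∧ ∀ a ∈ S, r a ≤ (x - a).orderTop := by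
  classical
  have hcoh : ∀ a ∈ S, ∀ b ∈ S, ∀ δ : Γ, (δ : WithTop Γ) < r a → (δ : WithTop Γ) < r b →
      a.coeff δ = b.coeff δ := by
    intro a ha b hb δ h1 h2
    have := HahnSeries.coeff_eq_zero_of_lt_orderTop ((lt_min h1 h2).trans_le (hr a ha b hb))
    rw [HahnSeries.coeff_sub] at this
    exact sub_eq_zero.1 this
  let c : Γ → A := fun δ =>
    if h : ∃ a ∈ S, (δ : WithTop Γ) < r a then h.choose.coeff δ else 0
  have hc : ∀ a ∈ S, ∀ δ : Γ, (δ : WithTop Γ) < r a → c δ = a.coeff δ := by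
    intro a ha δ hδ
    have h : ∃ a ∈ S, (δ : WithTop Γ) < r a := ⟨a, ha, hδ⟩
    simp only [c, dif_pos h]
    exact hcoh _ h.choose_spec.1 _ ha _ h.choose_spec.2 hδ
  have hc0 : ∀ δ : Γ, c δ ≠ 0 → ∃ a ∈ S, (δ : WithTop Γ) < r a := by
    intro δ hδ
    by_contra h
    exact hδ (by simp only [c, dif_neg h])
  have hwf : (Function.support c).IsWF := by
    rw [Set.isWF_iff_no_descending_seq]
    intro f hf hmem
    obtain ⟨a, ha, h0⟩ := hc0 _ (hmem 0)
    have hlt : ∀ n, (f n : WithTop Γ) < r a := fun n =>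
      (WithTop.coe_le_coe.2 (hf.antitone (Nat.zero_le n))).trans_lt h0
    have hwf := a.isWF_support
    rw [Set.isWF_iff_no_descending_seq] at hwf
    refine hwf f hf fun n => ?_
    have := hmem n
    rwa [Function.mem_support, hc a ha _ (hlt n)] at this
  refine ⟨⟨c, hwf.isPWO⟩, ?_, ?_⟩
  · intro δ hδ
    obtain ⟨a, ha, h⟩ := hc0 δ hδ
    refine hT a ha ?_
    rw [HahnSeries.mem_support, ← hc a ha δ h]
    exact hδ
  · intro a ha
    rw [HahnSeries.le_orderTop_iff_forall]
    intro j hj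
    rw [HahnSeries.coeff_sub, sub_eq_zero]
    exact hc a ha j hj

/-- If `ρ` distorts ultrametric distances on `S` monotonically and `S` is complete for the relevant
nested balls, then some point of `S` makes `ρ` as small as possible. Were there none, every `a ∈ S`
would have an improvement `b`, and the balls around `a` of radius `v (b - a)` would be nested; a
common point of all of them makes `ρ` as small as any point of `S` does. -/
theorem exists_max_val {X Y L : Type*} [AddCommGroup X] [AddCommGroup Y] [LinearOrder L]
    (vX : X → L) (vY : Y → L)
    (hX : ∀ a b, vX (a - b) = vX (b - a))
    (hneg : ∀ a, vY (-a) = vY a) (hadd : ∀ a b, min (vY a) (vY b) ≤ vY (a + b))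
    (S : Set X) (ρ : X → Y)
    (hρ : ∀ a ∈ S, ∀ b ∈ S, ∀ c ∈ S,
      vX (a - c) ≤ vX (b - c) ↔ vY (ρ a - ρ c) ≤ vY (ρ b - ρ c))
    (hS : ∀ r : X → L, (∀ a ∈ S, ∀ b ∈ S, min (r a) (r b) ≤ vX (a - b)) →
      (∀ a ∈ S, ∃ b ∈ S, r a = vX (b - a)) → ∃ x ∈ S, ∀ a ∈ S, r a ≤ vX (x - a)) :
    ∃ u ∈ S, ∀ u₁ ∈ S, vY (ρ u₁) ≤ vY (ρ u) := by
  have hsub : ∀ a b, min (vY a) (vY b) ≤ vY (a - b) := fun a b => by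
    simpa [sub_eq_add_neg, hneg] using hadd a (-b)
  have hlt : ∀ a b, vY a < vY b → vY (b - a) = vY a := by
    intro a b h
    refine le_antisymm ?_ ((min_eq_right h.le).symm.trans_le (hsub b a))
    by_contra! h1
    exact absurd (hsub b (b - a)) (by rw [sub_sub_cancel]; exact not_le.2 (lt_min h h1))
  by_contra! hno
  choose! j hjS hj using hno
  obtain ⟨x, hx, hxa⟩ := hS (fun a => vX (j a - a)) (by
    have key : ∀ a ∈ S, ∀ b ∈ S, vY (ρ a) ≤ vY (ρ b) → vX (j a - a) ≤ vX (b - a) := by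
      intro a ha b hb hab
      rw [hρ _ (hjS a ha) _ hb _ ha, hlt _ _ (hj a ha)]
      exact (le_min hab le_rfl).trans (hsub _ _)
    intro a ha b hb
    rcases le_total (vY (ρ a)) (vY (ρ b)) with h | h
    · exact (min_le_left _ _).trans ((key a ha b hb h).trans_eq (hX _ _))
    · exact (min_le_right _ _).trans (key b hb a ha h)) (fun a ha => ⟨j a, hjS a ha, rfl⟩)
  have h1 := hxa _ (hjS x hx)
  rw [hρ _ (hjS _ (hjS x hx)) _ hx _ (hjS x hx), hlt _ _ (hj _ (hjS x hx))] at h1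
  have h2 := hadd (ρ x - ρ (j x)) (ρ (j x))
  rw [sub_add_cancel, min_eq_right h1] at h2
  exact absurd (hj x hx) (not_lt.2 h2)

/-- Fixed points of contracting maps on Hahn series with support in a given set. -/
theorem exists_fixedPoint {Γ A : Type*} [LinearOrder Γ] [AddCommGroup A]
    (T : Set Γ) (Φ : HahnSeries Γ A → HahnSeries Γ A)
    (hΦ : ∀ a, a.support ⊆ T → (Φ a).support ⊆ T)
    (hc : ∀ a b, a.support ⊆ T → b.support ⊆ T → a ≠ b →
      (a - b).orderTop < (Φ a - Φ b).orderTop) :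
    ∃ x, x.support ⊆ T ∧ Φ x = x := by
  have hneg : ∀ a b : HahnSeries Γ A, (a - b).orderTop = (b - a).orderTop := fun a b => by
    rw [← HahnSeries.orderTop_neg, neg_sub]
  have hρ : ∀ a b, a.support ⊆ T → b.support ⊆ T →
      ((a - Φ a) - (b - Φ b)).orderTop = (a - b).orderTop := by
    intro a b ha hb
    rcases eq_or_ne a b with rfl | hab
    · simp
    · rw [show (a - Φ a) - (b - Φ b) = (a - b) - (Φ a - Φ b) by abel]
      exact HahnSeries.orderTop_sub (hc a b ha hb hab)
  obtain ⟨u, hu, hmax⟩ := exists_max_val (X := HahnSeries Γ A) (Y := HahnSeries Γ A)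
    (fun a => a.orderTop) (fun a => a.orderTop) hneg (fun a => HahnSeries.orderTop_neg)
    (fun a b => HahnSeries.min_orderTop_le_orderTop_add)
    {a | a.support ⊆ T} (fun a => a - Φ a)
    (fun a ha b hb c hc => by rw [hρ a c ha hc, hρ b c hb hc])
    (fun r h1 _ => exists_pseudoLimit T _ (fun a ha => ha) r h1)
  refine ⟨u, hu, ?_⟩
  by_contra hne
  exact absurd (hmax (Φ u) (hΦ u hu))
    (not_le.2 (hc u (Φ u) hu (hΦ u hu) (Ne.symm hne)))

/-! ### Summable families as Hahn series with finitely supported coefficients -/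

/-- The summable family indexed by `κ` that corresponds to a Hahn series with coefficients in
`κ →₀ C`: its `k`-th member is obtained by taking `k`-th components of coefficients. -/
noncomputable def familyOfSeries {Γ C κ : Type*} [LinearOrder Γ] [AddCommMonoid C]
    (y : HahnSeries Γ (κ →₀ C)) : HahnSeries.SummableFamily Γ C κ where
  toFun k := ⟨fun γ => y.coeff γ k, y.isPWO_support.mono fun γ h h0 => h (by simp [h0])⟩
  isPWO_iUnion_support' := y.isPWO_support.mono <| Set.iUnion_subset fun k γ h h0 =>
    h (by simp [h0])
  finite_co_support' γ := (y.coeff γ).hasFiniteSupport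

theorem coeff_familyOfSeries {Γ C κ : Type*} [LinearOrder Γ] [AddCommMonoid C]
    (y : HahnSeries Γ (κ →₀ C)) (k : κ) (γ : Γ) :
    (familyOfSeries y k).coeff γ = y.coeff γ k := rfl

/-- The inverse of `familyOfSeries`. -/
noncomputable def seriesOfFamily {Γ C κ : Type*} [LinearOrder Γ] [AddCommMonoid C]
    (s : HahnSeries.SummableFamily Γ C κ) : HahnSeries Γ (κ →₀ C) where
  coeff γ := s.coeff γ
  isPWO_support' := s.isPWO_iUnion_support.mono fun γ h => by
    by_contra h0
    refine h (Finsupp.ext fun k => ?_)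
    by_contra hk
    exact h0 (Set.mem_iUnion.2 ⟨k, hk⟩)

theorem coeff_seriesOfFamily {Γ C κ : Type*} [LinearOrder Γ] [AddCommMonoid C]
    (s : HahnSeries.SummableFamily Γ C κ) (k : κ) (γ : Γ) :
    (seriesOfFamily s).coeff γ k = (s k).coeff γ := rfl

theorem familyOfSeries_seriesOfFamily {Γ C κ : Type*} [LinearOrder Γ] [AddCommMonoid C]
    (s : HahnSeries.SummableFamily Γ C κ) : familyOfSeries (seriesOfFamily s) = s := by
  ext k γ
  rfl

/-! ### Asymptotic couples of H-type -/

/-- The properties of `ψ γ = γ†` that hold in an H-asymptotic field of characteristic zero: on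
positive elements `ψ` is decreasing and `γ ↦ γ′ = γ + ψ γ` is strictly increasing, and
`ψ (-γ) = ψ γ = ψ (2 γ)`. The value of `ψ` at `0` is irrelevant. -/
structure IsHCouple {Γ : Type*} [AddCommGroup Γ] [LinearOrder Γ] (ψ : Γ → Γ) : Prop where
  anti : ∀ α β, 0 < α → α ≤ β → ψ β ≤ ψ α
  mono : ∀ α β, 0 < α → α < β → α + ψ α < β + ψ β
  neg : ∀ α, ψ (-α) = ψ α
  double : ∀ α, ψ (α + α) = ψ α

namespace IsHCouple

variable {Γ : Type*} [AddCommGroup Γ] [LinearOrder Γ] {ψ : Γ → Γ}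

/-- `ψ` is constant on archimedean classes; the factor `2` suffices here. -/
theorem eq_of_le_double (h : IsHCouple ψ) {α β : Γ} (hα : 0 < α) (h1 : α ≤ β) (h2 : β ≤ α + α) :
    ψ β = ψ α := by
  refine le_antisymm (h.anti _ _ hα h1) ?_
  rw [← h.double α]
  exact h.anti _ _ (by grind) h2

variable [IsOrderedAddMonoid Γ]

/-- `Ψ < (Γ^>)′`. -/
theorem lt (h : IsHCouple ψ) {α β : Γ} (hα : α ≠ 0) (hβ : 0 < β) : ψ α < β + ψ β := by
  have key : ∀ α, 0 < α → ψ α < β + ψ β := by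
    intro α hα
    rcases le_or_gt β α with h1 | h1
    · have := h.anti β α hβ h1
      grind
    · have := h.mono α β hα h1
      grind
  rcases lt_or_gt_of_ne hα with h1 | h1
  · rw [← h.neg]
    exact key _ (by grind)
  · exact key _ h1

/-- The map `α ↦ α′ = α + ψ α` is strictly increasing on `Γ ∖ {0}`. -/
theorem prime_lt_prime (h : IsHCouple ψ) {α β : Γ} (hα : α ≠ 0) (hβ : β ≠ 0) (hαβ : α < β) :
    α + ψ α < β + ψ β := by
  rcases lt_or_gt_of_ne hα with h1 | h1
  · rcases lt_or_gt_of_ne hβ with h2 | h2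
    · have := h.anti (-β) (-α) (by grind) (by grind)
      rw [h.neg, h.neg] at this
      grind
    · have := h.lt hα h2
      grind
  · exact h.mono _ _ h1 hαβ

/-- The differences `ψ α - ψ β` are small compared with `β`. -/
theorem sub_add_sub_lt (h : IsHCouple ψ) {α β : Γ} (hα : 0 < α) (hβ : 0 < β) :
    (ψ α - ψ β) + (ψ α - ψ β) < β := by
  by_contra! h1
  have h0 : 0 < ψ α - ψ β := by grind
  have h2 := h.anti _ _ hβ h1
  rw [h.double] at h2
  have h3 := h.lt hα.ne' h0
  grind

variable {H : AddSubgroup Γ}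

/-- The set `(H^>)′` is upward closed in `H`. -/
theorem exists_prime_eq_of_le (h : IsHCouple ψ) (hψ : ∀ γ ∈ H, γ ≠ 0 → ψ γ ∈ H) {α β : Γ}
    (hα : 0 < α) (hαH : α ∈ H) (hβ : β ∈ H) (hle : α + ψ α ≤ β) :
    ∃ γ ∈ H, 0 < γ ∧ γ + ψ γ = β := by
  have h1 : β - ψ α ∈ H := H.sub_mem hβ (hψ _ hαH hα.ne')
  have h2 : α ≤ β - ψ α := by grind
  have h3 := h.anti _ _ hα h2
  have h4 : 0 < β - ψ α := hα.trans_le h2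
  have h5 := h.sub_add_sub_lt hα h4
  have h6 : ψ (β - ψ (β - ψ α)) = ψ (β - ψ α) := h.eq_of_le_double h4 (by grind) (by grind)
  refine ⟨β - ψ (β - ψ α), H.sub_mem hβ (hψ _ h1 h4.ne'), by grind, ?_⟩
  rw [h6]
  grind

/-- An element `s` of `H` that is not of the form `γ′` with `γ ∈ H ∖ {0}` is an upper bound for
`ψ (H^>)`. -/
theorem psi_le_of_forall_ne (h : IsHCouple ψ) (hψ : ∀ γ ∈ H, γ ≠ 0 → ψ γ ∈ H) {s : Γ}
    (hs : s ∈ H) (hne : ∀ γ ∈ H, γ ≠ 0 → γ + ψ γ ≠ s) {α : Γ} (hα : 0 < α) (hαH : α ∈ H) :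
    ψ α ≤ s := by
  -- no solution of `γ′ = s` of the form `γ = s - ψ b`
  have hne' : ∀ b ∈ H, 0 < b → s < ψ b → ψ (ψ b - s) ≠ ψ b := by
    intro b hb hb0 hsb heq
    refine hne (-(ψ b - s)) (H.neg_mem (H.sub_mem (hψ _ hb hb0.ne') hs)) (by grind) ?_
    rw [h.neg, heq]
    grind
  -- the case where `ψ` drops
  have key : ∀ b ∈ H, 0 < b → s < ψ b → ¬ ψ (ψ b - s) < ψ b := by
    intro b hb hb0 hsb hlt
    have ha : 0 < ψ b - s := by grind
    have haH : ψ b - s ∈ H := H.sub_mem (hψ _ hb hb0.ne') hs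
    have h1 := h.sub_add_sub_lt hb0 ha
    have h2 : ψ (ψ b - s) = ψ (ψ (ψ b - s) - s) :=
      h.eq_of_le_double (by grind) (by grind) (by grind)
    exact hne' _ haH ha (by grind) h2.symm
  by_contra! hlt
  have ha : 0 < ψ α - s := by grind
  have haH : ψ α - s ∈ H := H.sub_mem (hψ _ hαH hα.ne') hs
  rcases lt_trichotomy (ψ (ψ α - s)) (ψ α) with h1 | h1 | h1
  · exact key _ hαH hα hlt h1
  · exact hne' _ hαH hα hlt h1
  · have h2 : ψ (ψ (ψ α - s) - s) ≤ ψ (ψ α - s) := h.anti _ _ ha (by grind)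
    rcases h2.lt_or_eq with h3 | h3
    · exact key _ haH ha (by grind) h3
    · exact hne' _ haH ha (by grind) h3

end IsHCouple

/-! ### The valuation on the direct limit -/

section

variable {Γ : Type u} [AddCommGroup Γ] [LinearOrder Γ] [IsOrderedAddMonoid Γ]
variable {C : Type v} [Field C] {D : Type w} {G : D → AddSubgroup Γ}

variable (C G) in
/-- The valuation `val` as an additive valuation. -/
noncomputable def limVal : AddValuation (Lim C G) (WithTop Γ) :=
  (HahnSeries.addVal Γ C).comap (Lim.series (C := C) (G := G)).toRingHom

theorem Lim.series_injective : Function.Injective (Lim.series (C := C) (G := G)) :=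
  (Lim.series (C := C) (G := G)).toRingHom.injective

theorem val_eq_top {x : Lim C G} : val x = ⊤ ↔ x = 0 := by
  rw [val, HahnSeries.orderTop_eq_top, map_eq_zero_iff _ Lim.series_injective]

theorem val_zero : val (0 : Lim C G) = ⊤ := val_eq_top.2 rfl

theorem val_one : val (1 : Lim C G) = 0 := (limVal C G).map_one

theorem val_mul (x y : Lim C G) : val (x * y) = val x + val y := (limVal C G).map_mul x y

theorem val_neg (x : Lim C G) : val (-x) = val x := (limVal C G).map_neg x

theorem val_sub_comm (x y : Lim C G) : val (x - y) = val (y - x) := (limVal C G).map_sub_swap x y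

theorem min_val_le_add (x y : Lim C G) : min (val x) (val y) ≤ val (x + y) :=
  (limVal C G).map_add x y

theorem min_val_le_sub (x y : Lim C G) : min (val x) (val y) ≤ val (x - y) :=
  (limVal C G).map_sub x y

theorem lt_val_add {x y : Lim C G} {γ : WithTop Γ} (hx : γ < val x) (hy : γ < val y) :
    γ < val (x + y) := (limVal C G).map_lt_add hx hy

theorem lt_val_sub {x y : Lim C G} {γ : WithTop Γ} (hx : γ < val x) (hy : γ < val y) :
    γ < val (x - y) := (lt_min hx hy).trans_le (min_val_le_sub x y)

theorem val_add_eq_left {x y : Lim C G} (h : val x < val y) : val (x + y) = val x :=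
  (limVal C G).map_add_eq_of_lt_left h

theorem val_sub_eq_left {x y : Lim C G} (h : val x < val y) : val (x - y) = val x := by
  rw [sub_eq_add_neg]; exact val_add_eq_left (by rwa [val_neg])

theorem exists_val_eq {x : Lim C G} (hx : x ≠ 0) : ∃ γ : Γ, val x = γ :=
  ⟨(val x).untop (val_eq_top.not.2 hx), by simp⟩

theorem ne_zero_of_val {x : Lim C G} {γ : Γ} (hx : val x = γ) : x ≠ 0 := by
  rintro rfl
  simp [val_zero] at hx

theorem val_inv {x : Lim C G} {γ : Γ} (hx : val x = γ) : val x⁻¹ = ((-γ : Γ) : WithTop Γ) := by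
  have hx0 := ne_zero_of_val hx
  obtain ⟨δ, hδ⟩ := exists_val_eq (inv_ne_zero hx0)
  have h := val_mul x x⁻¹
  rw [mul_inv_cancel₀ hx0, val_one, hx, hδ] at h
  norm_cast at h
  rw [hδ]
  norm_cast
  grind

theorem val_div {x y : Lim C G} {γ δ : Γ} (hx : val x = γ) (hy : val y = δ) :
    val (x / y) = ((γ - δ : Γ) : WithTop Γ) := by
  rw [div_eq_mul_inv, val_mul, hx, val_inv hy, sub_eq_add_neg]
  rfl

theorem order_series {x : Lim C G} {γ : Γ} (hx : val x = γ) : (Lim.series x).order = γ := by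
  have := HahnSeries.order_eq_orderTop_of_ne_zero
    (show Lim.series x ≠ 0 by
      rw [Ne, map_eq_zero_iff _ Lim.series_injective]; exact ne_zero_of_val hx)
  exact WithTop.coe_injective (this.trans hx)

theorem series_algebraMap (c : C) :
    Lim.series (algebraMap C (Lim C G) c) = HahnSeries.single 0 c := by
  rw [AlgHom.commutes]
  rfl

theorem val_algebraMap {c : C} (hc : c ≠ 0) : val (algebraMap C (Lim C G) c) = 0 := by
  rw [val, series_algebraMap, HahnSeries.orderTop_single hc]
  rfl

theorem val_smul {c : C} (hc : c ≠ 0) (x : Lim C G) : val (c • x) = val x := by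
  rw [Algebra.smul_def, val_mul, val_algebraMap hc, zero_add]

theorem val_le_smul (c : C) (x : Lim C G) : val x ≤ val (c • x) := by
  rcases eq_or_ne c 0 with rfl | hc
  · simp [val_zero]
  · exact (val_smul hc x).ge

/-- The residue field is `C`. -/
theorem exists_lt_val_sub {x : Lim C G} (hx : 0 ≤ val x) :
    ∃ c : C, 0 < val (x - algebraMap C (Lim C G) c) := by
  refine ⟨(Lim.series x).coeff 0, ?_⟩
  have h : 0 ≤ val (x - algebraMap C (Lim C G) ((Lim.series x).coeff 0)) := by
    refine (le_min hx ?_).trans (min_val_le_sub _ _)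
    rw [val, series_algebraMap]
    exact HahnSeries.orderTop_single_le
  refine lt_of_le_of_ne h (Ne.symm ?_)
  refine HahnSeries.orderTop_ne_of_coeff_eq_zero ?_
  rw [map_sub, series_algebraMap]
  simp

/-- Elements of equal valuation agree to leading order up to a constant factor. -/
theorem exists_lt_val_sub_smul {x y : Lim C G} {γ : Γ} (hx : val x = γ) (hy : val y = γ) :
    ∃ c : C, c ≠ 0 ∧ val x < val (x - c • y) := by
  have hy0 := ne_zero_of_val hy
  obtain ⟨c, hc⟩ := exists_lt_val_sub (x := x / y) (by rw [val_div hx hy]; simp)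
  have h1 : val x < val (x - c • y) := by
    have h2 : x - c • y = (x / y - algebraMap C (Lim C G) c) * y := by
      rw [Algebra.smul_def]; field_simp
    rw [h2, val_mul, hx, hy]
    have := WithTop.add_lt_add_right (WithTop.coe_ne_top (a := γ)) hc
    rwa [zero_add] at this
  refine ⟨c, ?_, h1⟩
  rintro rfl
  simp at h1

/-! ### The stages -/

theorem inStage_iff {d : D} {x : Lim C G} :
    InStage d x ↔ ∀ γ, (Lim.series x).coeff γ ≠ 0 → γ ∈ G d := mem_hahnSub_iff

namespace InStage

variable {d : D} {x y : Lim C G}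

theorem zero : InStage d (0 : Lim C G) := by
  rw [InStage, map_zero]; exact zero_mem _

theorem add (hx : InStage d x) (hy : InStage d y) : InStage d (x + y) := by
  rw [InStage, map_add]; exact add_mem hx hy

theorem sub (hx : InStage d x) (hy : InStage d y) : InStage d (x - y) := by
  rw [InStage, map_sub]; exact sub_mem hx hy

theorem neg (hx : InStage d x) : InStage d (-x) := by
  rw [InStage, map_neg]; exact neg_mem hx

theorem mul (hx : InStage d x) (hy : InStage d y) : InStage d (x * y) := by
  rw [InStage, map_mul]; exact mul_mem hx hy

theorem inv (hx : InStage d x) : InStage d x⁻¹ := by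
  rw [InStage, map_inv₀]; exact inv_mem hx

theorem algebraMap (c : C) : InStage d (algebraMap C (Lim C G) c) := by
  rw [InStage, AlgHom.commutes]; exact IntermediateField.algebraMap_mem _ _

theorem one : InStage d (1 : Lim C G) := by
  rw [InStage, map_one]; exact one_mem _

theorem smul (c : C) (hx : InStage d x) : InStage d (c • x) := by
  rw [Algebra.smul_def]; exact (algebraMap c).mul hx

theorem mono [Preorder D] (hG : Monotone G) {e : D} (hde : d ≤ e) (hx : InStage d x) :
    InStage e x := hahnSub_mono (hG hde) hx

theorem val_mem (hx : InStage d x) {γ : Γ} (h : val x = γ) : γ ∈ G d :=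
  inStage_iff.1 hx γ (HahnSeries.coeff_orderTop_ne h)

end InStage

theorem mem_hahnLimit_of_stage {d : D} {s : HahnSeries Γ C} (hs : s ∈ hahnSub C (G d)) :
    s ∈ hahnLimit C G := (le_iSup (fun d => hahnSub C (G d)) d : _) hs

theorem exists_series_eq {d : D} {s : HahnSeries Γ C} (hs : ∀ γ, s.coeff γ ≠ 0 → γ ∈ G d) :
    ∃ x : Lim C G, Lim.series x = s ∧ InStage d x :=
  ⟨⟨s, mem_hahnLimit_of_stage (mem_hahnSub_iff.2 hs)⟩, rfl, mem_hahnSub_iff.2 hs⟩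

theorem exists_inStage [Preorder D] [IsDirectedOrder D] [Nonempty D] (hG : Monotone G)
    (x : Lim C G) : ∃ d, InStage d x := (mem_hahnLimit_iff C G hG).1 x.2

theorem exists_inStage₂ [Preorder D] [IsDirectedOrder D] [Nonempty D] (hG : Monotone G)
    (x y : Lim C G) : ∃ d, InStage d x ∧ InStage d y := by
  obtain ⟨d, hd⟩ := exists_inStage hG x
  obtain ⟨e, he⟩ := exists_inStage hG y
  obtain ⟨f, hdf, hef⟩ := exists_ge_ge d e
  exact ⟨f, hd.mono hG hdf, he.mono hG hef⟩

/-- The monomials `t^γ` lie in the stages that contain `γ`. -/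
theorem exists_monomial {d : D} {γ : Γ} (hγ : γ ∈ G d) :
    ∃ x : Lim C G, Lim.series x = HahnSeries.single γ 1 ∧ InStage d x ∧ val x = γ := by
  obtain ⟨x, hx, hd⟩ := exists_series_eq (C := C) (G := G) (d := d)
    (s := HahnSeries.single γ (1 : C)) (by
      intro δ hδ
      rw [HahnSeries.coeff_single] at hδ
      have : δ = γ := by by_contra h; simp [h] at hδ
      exact this ▸ hγ)
  exact ⟨x, hx, hd, by rw [val, hx, HahnSeries.orderTop_single one_ne_zero]⟩

end

section

variable {Γ : Type u} [AddCommGroup Γ] [LinearOrder Γ] [IsOrderedAddMonoid Γ]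
variable {C : Type v} [Field C] {D : Type w} {G : D → AddSubgroup Γ}

/-! ### Summable families in the direct limit -/

theorem exists_ne_zero_of_finsum_ne_zero {α M : Type*} [AddCommMonoid M] {f : α → M}
    (h : ∑ᶠ a, f a ≠ 0) : ∃ a, f a ≠ 0 := by
  by_contra! h'
  exact h (by simp [h'])

section Families

variable {κ μ : Type*}

namespace HasStrongSum

variable {F F' : κ → Lim C G} {x y : Lim C G}

theorem finite_coeff (h : HasStrongSum F x) (γ : Γ) :
    (Function.support fun k => (Lim.series (F k)).coeff γ).Finite := by
  obtain ⟨-, s, hs, -⟩ := h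
  simp only [← hs]
  exact s.finite_co_support γ

theorem coeff_eq (h : HasStrongSum F x) (γ : Γ) :
    (Lim.series x).coeff γ = ∑ᶠ k, (Lim.series (F k)).coeff γ := by
  obtain ⟨-, s, hs, hx⟩ := h
  rw [← hx, HahnSeries.SummableFamily.coeff_hsum]
  simp only [hs]

theorem unique (h : HasStrongSum F x) (h' : HasStrongSum F y) : x = y := by
  apply Lim.series_injective
  ext γ
  rw [h.coeff_eq, h'.coeff_eq]

/-- Beyond finitely many terms, the sum is at most as large as one of the remaining terms. -/
theorem exists_val_le (h : HasStrongSum F x) (s : Finset κ) (hne : x - ∑ k ∈ s, F k ≠ 0) :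
    ∃ k ∉ s, F k ≠ 0 ∧ val (F k) ≤ val (x - ∑ k ∈ s, F k) := by
  obtain ⟨γ, hγ⟩ := exists_val_eq hne
  have h1 := HahnSeries.coeff_orderTop_ne hγ
  rw [map_sub, HahnSeries.coeff_sub, h.coeff_eq, map_sum, HahnSeries.coeff_sum] at h1
  have h2 : ∃ k ∉ s, (Lim.series (F k)).coeff γ ≠ 0 := by
    by_contra! h2
    refine h1 (sub_eq_zero.2 (finsum_eq_sum_of_support_subset _ fun k hk => ?_))
    by_contra hks
    exact hk (h2 k hks)
  obtain ⟨k, hks, hk⟩ := h2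
  refine ⟨k, hks, ?_, ?_⟩
  · rintro h0
    simp [h0] at hk
  · rw [hγ]
    exact HahnSeries.orderTop_le_of_coeff_ne_zero hk

theorem inStage (h : HasStrongSum F x) {d : D} (hF : ∀ k, InStage d (F k)) : InStage d x := by
  refine inStage_iff.2 fun γ hγ => ?_
  rw [h.coeff_eq] at hγ
  obtain ⟨k, hk⟩ := exists_ne_zero_of_finsum_ne_zero hγ
  exact inStage_iff.1 (hF k) γ hk

theorem of_summableFamily (s : HahnSeries.SummableFamily Γ C κ) {d : D}
    (hF : ∀ k, InStage d (F k)) (hs : ∀ k, s k = Lim.series (F k)) :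
    ∃ x, HasStrongSum F x := by
  obtain ⟨x, hx, -⟩ := exists_series_eq (C := C) (G := G) (d := d) (s := s.hsum) (by
    intro γ hγ
    rw [HahnSeries.SummableFamily.coeff_hsum] at hγ
    obtain ⟨k, hk⟩ := exists_ne_zero_of_finsum_ne_zero hγ
    rw [hs] at hk
    exact inStage_iff.1 (hF k) γ hk)
  exact ⟨x, ⟨d, hF⟩, s, hs, hx.symm⟩

/-- Regrouping: a family `E` that collects the members of a summable family `F` in groups, the
fibres of `π`, is summable with the same sum. The groups may be infinite, so the agreement of the
sums of coefficients is a hypothesis. -/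
theorem regroup (h : HasStrongSum F x) {E : μ → Lim C G} (hE : ∃ d, ∀ m, InStage d (E m))
    (π : κ → μ)
    (hsupp : ∀ m γ, (Lim.series (E m)).coeff γ ≠ 0 →
      ∃ k, π k = m ∧ (Lim.series (F k)).coeff γ ≠ 0)
    (hsum : ∀ γ, ∑ᶠ m, (Lim.series (E m)).coeff γ = ∑ᶠ k, (Lim.series (F k)).coeff γ) :
    HasStrongSum E x := by
  have hfin := h.finite_coeff
  have hx := h.coeff_eq
  obtain ⟨-, s, hs, -⟩ := h
  let t : HahnSeries.SummableFamily Γ C μ :=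
    { toFun := fun m => Lim.series (E m)
      isPWO_iUnion_support' := s.isPWO_iUnion_support.mono <| Set.iUnion_subset fun m γ hγ => by
        obtain ⟨k, -, hk⟩ := hsupp m γ hγ
        exact Set.mem_iUnion.2 ⟨k, by rw [hs]; exact hk⟩
      finite_co_support' := fun γ => ((hfin γ).image π).subset fun m hm => by
        obtain ⟨k, hkm, hk⟩ := hsupp m γ hm
        exact ⟨k, hk, hkm⟩ }
  refine ⟨hE, t, fun m => rfl, ?_⟩
  ext γ
  rw [HahnSeries.SummableFamily.coeff_hsum, hx, ← hsum]
  rfl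

theorem sum_rows {F : κ × μ → Lim C G} (h : HasStrongSum F x) {E : κ → Lim C G}
    (hE : ∀ i, HasStrongSum (fun j => F (i, j)) (E i)) : HasStrongSum E x := by
  obtain ⟨d, hd⟩ := h.1
  refine h.regroup ⟨d, fun i => (hE i).inStage fun j => hd _⟩ Prod.fst ?_ ?_
  · intro i γ hγ
    rw [(hE i).coeff_eq] at hγ
    obtain ⟨j, hj⟩ := exists_ne_zero_of_finsum_ne_zero hγ
    exact ⟨(i, j), rfl, hj⟩
  · intro γ
    rw [finsum_curry _ (h.finite_coeff γ)]
    exact finsum_congr fun i => (hE i).coeff_eq γ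

theorem comp_equiv (h : HasStrongSum F x) (e : μ ≃ κ) : HasStrongSum (F ∘ e) x := by
  obtain ⟨d, hd⟩ := h.1
  refine h.regroup ⟨d, fun m => hd _⟩ e.symm ?_ ?_
  · exact fun m γ hγ => ⟨e m, e.symm_apply_apply m, hγ⟩
  · exact fun γ => finsum_comp_equiv e (f := fun k => (Lim.series (F k)).coeff γ)

theorem sum_columns {F : κ × μ → Lim C G} (h : HasStrongSum F x) {E : μ → Lim C G}
    (hE : ∀ j, HasStrongSum (fun i => F (i, j)) (E j)) : HasStrongSum E x :=
  (h.comp_equiv (Equiv.prodComm μ κ)).sum_rows hE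

theorem sum_antidiagonal {F : ℕ × ℕ → Lim C G} (h : HasStrongSum F x) :
    HasStrongSum (fun n => ∑ p ∈ Finset.HasAntidiagonal.antidiagonal n, F p) x := by
  obtain ⟨d, hd⟩ := h.1
  have hco : ∀ n γ, (Lim.series (∑ p ∈ Finset.HasAntidiagonal.antidiagonal n, F p)).coeff γ =
      ∑ p ∈ Finset.HasAntidiagonal.antidiagonal n, (Lim.series (F p)).coeff γ := fun n γ => by
    rw [map_sum, HahnSeries.coeff_sum]
  refine h.regroup ⟨d, fun n => Finset.sum_induction _ _ (fun _ _ => InStage.add) InStage.zero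
    fun p _ => hd p⟩ (fun p => p.1 + p.2) ?_ ?_
  · intro n γ hγ
    rw [hco] at hγ
    obtain ⟨p, hp, hpγ⟩ := Finset.exists_ne_zero_of_sum_ne_zero hγ
    exact ⟨p, Finset.HasAntidiagonal.mem_antidiagonal.1 hp, hpγ⟩
  · intro γ
    have hfin := h.finite_coeff γ
    have hmem : ∀ p, (Lim.series (F p)).coeff γ ≠ 0 → p ∈ hfin.toFinset := fun p hp => by
      simpa using hp
    rw [finsum_eq_sum_of_support_subset (s := hfin.toFinset) _ (fun p hp => hmem p hp),
      finsum_eq_sum_of_support_subset (s := hfin.toFinset.image fun p => p.1 + p.2)]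
    · rw [← Finset.sum_fiberwise_of_maps_to (s := hfin.toFinset) (g := fun p => p.1 + p.2)
        fun p hp => Finset.mem_image_of_mem _ hp]
      refine Finset.sum_congr rfl fun n _ => ?_
      rw [hco]
      refine (Finset.sum_subset (fun p hp => ?_) fun p hp hp' => ?_).symm
      · simpa using (Finset.mem_filter.1 hp).2
      · by_contra h0
        exact hp' (Finset.mem_filter.2 ⟨hmem p h0, Finset.HasAntidiagonal.mem_antidiagonal.1 hp⟩)
    · intro n hn
      rw [Function.mem_support, hco] at hn
      obtain ⟨p, hp, hpγ⟩ := Finset.exists_ne_zero_of_sum_ne_zero hn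
      rw [Finset.mem_coe]
      exact Finset.mem_image.2 ⟨p, hmem p hpγ, Finset.HasAntidiagonal.mem_antidiagonal.1 hp⟩

theorem add (h : HasStrongSum F x) (h' : HasStrongSum F' y)
    (hd : ∃ d, ∀ k, InStage d (F k + F' k)) :
    HasStrongSum (fun k => F k + F' k) (x + y) := by
  obtain ⟨-, s, hs, hx⟩ := h
  obtain ⟨-, s', hs', hy⟩ := h'
  exact ⟨hd, s + s', fun k => by simp [hs, hs'], by
    rw [HahnSeries.SummableFamily.hsum_add, hx, hy, map_add]⟩

theorem sub (h : HasStrongSum F x) (h' : HasStrongSum F' y)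
    (hd : ∃ d, ∀ k, InStage d (F k - F' k)) :
    HasStrongSum (fun k => F k - F' k) (x - y) := by
  obtain ⟨-, s, hs, hx⟩ := h
  obtain ⟨-, s', hs', hy⟩ := h'
  exact ⟨hd, s - s', fun k => by simp [hs, hs'], by
    rw [HahnSeries.SummableFamily.hsum_sub, hx, hy, map_sub]⟩

theorem mul {E : μ → Lim C G} [Preorder D] [IsDirectedOrder D] (hG : Monotone G)
    (h : HasStrongSum F x) (h' : HasStrongSum E y) :
    HasStrongSum (fun p : κ × μ => F p.1 * E p.2) (x * y) := by
  obtain ⟨⟨d, hd⟩, s, hs, hx⟩ := h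
  obtain ⟨⟨e, he⟩, s', hs', hy⟩ := h'
  obtain ⟨f, hdf, hef⟩ := exists_ge_ge d e
  exact ⟨⟨f, fun p => ((hd _).mono hG hdf).mul ((he _).mono hG hef)⟩, s.mul s',
    fun p => by simp [hs, hs'], by
      rw [HahnSeries.SummableFamily.hsum_mul, hx, hy, map_mul]⟩

theorem mul_left (h : HasStrongSum F x) (a : Lim C G) (hd : ∃ d, ∀ k, InStage d (a * F k)) :
    HasStrongSum (fun k => a * F k) (a * x) := by
  obtain ⟨-, s, hs, hx⟩ := h
  exact ⟨hd, Lim.series a • s, fun k => by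
    rw [HahnSeries.SummableFamily.smul_apply, hs, map_mul]
    exact HahnSeries.of_symm_smul_of_eq_mul, by
    rw [HahnSeries.SummableFamily.hsum_smul, hx, map_mul]⟩

end HasStrongSum

/-- `F` is a summable family in `𝕊_d`. -/
def SummableAt (d : D) (F : κ → Lim C G) : Prop :=
  (∀ k, InStage d (F k)) ∧ ∃ x, HasStrongSum F x

namespace SummableAt

variable {d : D} {F F' : κ → Lim C G}

theorem add (h : SummableAt d F) (h' : SummableAt d F') : SummableAt d fun k => F k + F' k := by
  obtain ⟨hd, x, hx⟩ := h
  obtain ⟨hd', x', hx'⟩ := h'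
  exact ⟨fun k => (hd k).add (hd' k), _, hx.add hx' ⟨d, fun k => (hd k).add (hd' k)⟩⟩

theorem sub (h : SummableAt d F) (h' : SummableAt d F') : SummableAt d fun k => F k - F' k := by
  obtain ⟨hd, x, hx⟩ := h
  obtain ⟨hd', x', hx'⟩ := h'
  exact ⟨fun k => (hd k).sub (hd' k), _, hx.sub hx' ⟨d, fun k => (hd k).sub (hd' k)⟩⟩

theorem smul (h : SummableAt d F) (c : κ → C) : SummableAt d fun k => c k • F k := by
  obtain ⟨hd, x, -, s, hs, -⟩ := h
  exact ⟨fun k => (hd k).smul _, HasStrongSum.of_summableFamily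
    (HahnSeries.SummableFamily.smulFamily c s) (fun k => (hd k).smul _) fun k => by
      rw [map_smul, ← hs]; rfl⟩

theorem comp_injective (h : SummableAt d F) {e : μ → κ} (he : Function.Injective e) :
    SummableAt d (F ∘ e) := by
  obtain ⟨hd, x, -, s, hs, -⟩ := h
  refine ⟨fun m => hd _, HasStrongSum.of_summableFamily
    { toFun := fun m => s (e m)
      isPWO_iUnion_support' := s.isPWO_iUnion_support.mono
        (Set.iUnion_subset fun m => Set.subset_iUnion (fun k => (s k).support) (e m))
      finite_co_support' := fun γ => (s.finite_co_support γ).preimage he.injOn }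
    (fun m => hd _) fun m => hs (e m)⟩

theorem extend (h : SummableAt d F) {e : κ → μ} (he : Function.Injective e) {E : μ → Lim C G}
    (h1 : ∀ k, E (e k) = F k) (h2 : ∀ m, m ∉ Set.range e → E m = 0) : SummableAt d E := by
  obtain ⟨hd, x, -, s, hs, -⟩ := h
  have hE : ∀ m, InStage d (E m) := fun m => by
    by_cases hm : m ∈ Set.range e
    · obtain ⟨k, rfl⟩ := hm
      rw [h1]; exact hd k
    · rw [h2 m hm]; exact InStage.zero
  refine ⟨hE, HasStrongSum.of_summableFamily (s.embDomain ⟨e, he⟩) hE fun m => ?_⟩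
  by_cases hm : m ∈ Set.range e
  · obtain ⟨k, rfl⟩ := hm
    rw [h1, ← hs]
    exact HahnSeries.SummableFamily.embDomain_image s ⟨e, he⟩
  · rw [h2 m hm, map_zero]
    exact HahnSeries.SummableFamily.embDomain_of_notMem_range s ⟨e, he⟩ hm

theorem of_inStage {x : Lim C G} (h : InStage d x) : SummableAt d fun _ : PUnit.{u + 1} => x :=
  ⟨fun _ => h, HasStrongSum.of_summableFamily (HahnSeries.SummableFamily.const _ (Lim.series x))
    (fun _ => h) fun _ => rfl⟩

/-- A contracting map on the summable families in `𝕊_d` has a fixed point. -/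
theorem exists_fixedPoint (Φ : (κ → Lim C G) → κ → Lim C G)
    (hΦ : ∀ F, SummableAt d F → SummableAt d (Φ F))
    (hc : ∀ F E, SummableAt d F → SummableAt d E → ∀ γ : Γ,
      (∀ k, (γ : WithTop Γ) ≤ val (F k - E k)) → ∀ k, (γ : WithTop Γ) < val (Φ F k - Φ E k)) :
    ∃ F : κ → Lim C G, SummableAt d F ∧ Φ F = F := by
  classical
  -- transport to Hahn series with coefficients in `κ →₀ C`
  have hdec : ∀ y : HahnSeries Γ (κ →₀ C), y.support ⊆ G d →
      ∃ F : κ → Lim C G, SummableAt d F ∧ ∀ k, Lim.series (F k) = familyOfSeries y k := by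
    intro y hy
    have hst : ∀ k, ∃ x : Lim C G, Lim.series x = familyOfSeries y k ∧ InStage d x := fun k =>
      exists_series_eq fun γ hγ => hy fun h0 => hγ (by rw [coeff_familyOfSeries, h0]; rfl)
    choose F hF hFd using hst
    exact ⟨F, ⟨hFd, HasStrongSum.of_summableFamily (familyOfSeries y) hFd fun k => (hF k).symm⟩,
      hF⟩
  have henc : ∀ F : κ → Lim C G, SummableAt d F →
      ∃ y : HahnSeries Γ (κ →₀ C), y.support ⊆ G d ∧
        ∀ k, Lim.series (F k) = familyOfSeries y k := by
    rintro F ⟨hd, x, -, s, hs, -⟩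
    refine ⟨seriesOfFamily s, fun γ hγ => ?_, fun k => by
      rw [familyOfSeries_seriesOfFamily, hs]⟩
    obtain ⟨k, hk⟩ := Finsupp.ne_iff.1 hγ
    refine inStage_iff.1 (hd k) γ ?_
    rw [← hs, ← coeff_seriesOfFamily]
    exact hk
  choose! dec hdec hdec' using hdec
  choose! enc henc henc' using henc
  have hcoeff : ∀ F : κ → Lim C G, SummableAt d F → ∀ k γ,
      (enc F).coeff γ k = (Lim.series (F k)).coeff γ := fun F hF k γ => by
    rw [henc' F hF, coeff_familyOfSeries]
  obtain ⟨y, hy, hfix⟩ := HahnConj.exists_fixedPoint (Γ := Γ) (A := κ →₀ C) (G d : Set Γ)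
    (fun y => enc (Φ (dec y))) (fun y hy => henc _ (hΦ _ (hdec y hy))) (by
      intro a b ha hb hab
      obtain ⟨γ, hγ⟩ : ∃ γ : Γ, (a - b).orderTop = γ :=
        ⟨_, HahnSeries.orderTop_of_ne_zero (sub_ne_zero.2 hab)⟩
      rw [hγ]
      have h1 := hc _ _ (hdec a ha) (hdec b hb) γ (by
        intro k
        rw [val, HahnSeries.le_orderTop_iff_forall]
        intro δ hδ
        rw [map_sub, hdec' a ha, hdec' b hb, HahnSeries.coeff_sub, coeff_familyOfSeries,
          coeff_familyOfSeries, ← Finsupp.sub_apply, ← HahnSeries.coeff_sub,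
          HahnSeries.coeff_eq_zero_of_lt_orderTop (hγ ▸ hδ), Finsupp.zero_apply])
      by_contra hle
      rw [not_lt] at hle
      obtain ⟨δ, hδγ, hδ⟩ : ∃ δ : Γ, δ ≤ γ ∧
          (enc (Φ (dec a)) - enc (Φ (dec b))).orderTop = δ := by
        obtain ⟨δ, hδ⟩ := WithTop.ne_top_iff_exists.1 (ne_top_of_le_ne_top WithTop.coe_ne_top hle)
        exact ⟨δ, by rw [← hδ] at hle; exact_mod_cast hle, hδ.symm⟩
      refine HahnSeries.coeff_orderTop_ne hδ (Finsupp.ext fun k => ?_)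
      rw [HahnSeries.coeff_sub, Finsupp.sub_apply, hcoeff _ (hΦ _ (hdec a ha)),
        hcoeff _ (hΦ _ (hdec b hb)), ← HahnSeries.coeff_sub, ← map_sub]
      exact HahnSeries.coeff_eq_zero_of_lt_orderTop
        ((WithTop.coe_le_coe.2 hδγ).trans_lt (h1 k)))
  refine ⟨dec y, hdec y hy, funext fun k => Lim.series_injective ?_⟩
  rw [henc' _ (hΦ _ (hdec y hy)), hfix, hdec' y hy]

end SummableAt

end Families

end

section

variable {Γ : Type u} [AddCommGroup Γ] [LinearOrder Γ] [IsOrderedAddMonoid Γ]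
variable {C : Type v} [Field C] {D : Type w} {G : D → AddSubgroup Γ}

/-! ### Strongly linear operators -/

/-- `φ` maps `𝕊_d` into itself, by a strongly linear map. -/
def IsStrongAt (d : D) (φ : Lim C G →ₗ[C] Lim C G) : Prop :=
  (∀ x, InStage d x → InStage d (φ x)) ∧
    ∀ (ι : Type u) (F : ι → Lim C G) (x : Lim C G), (∀ i, InStage d (F i)) →
      HasStrongSum F x → HasStrongSum (fun i => φ (F i)) (φ x)

namespace IsStrongAt

variable {d : D} {φ χ : Lim C G →ₗ[C] Lim C G}

theorem one : IsStrongAt d (1 : Lim C G →ₗ[C] Lim C G) :=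
  ⟨fun _ h => h, fun _ _ _ _ h => h⟩

theorem mul (h : IsStrongAt d φ) (h' : IsStrongAt d χ) : IsStrongAt d (φ * χ) :=
  ⟨fun _ hx => h.1 _ (h'.1 _ hx), fun ι F x hF hx =>
    h.2 ι _ _ (fun i => h'.1 _ (hF i)) (h'.2 ι F x hF hx)⟩

theorem pow (h : IsStrongAt d φ) (n : ℕ) : IsStrongAt d (φ ^ n) := by
  induction n with
  | zero => exact one
  | succ n ih => exact pow_succ φ n ▸ ih.mul h

theorem sub (h : IsStrongAt d φ) (h' : IsStrongAt d χ) : IsStrongAt d (φ - χ) :=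
  ⟨fun _ hx => (h.1 _ hx).sub (h'.1 _ hx), fun ι F x hF hx =>
    (h.2 ι F x hF hx).sub (h'.2 ι F x hF hx) ⟨d, fun i => (h.1 _ (hF i)).sub (h'.1 _ (hF i))⟩⟩

theorem mulLeft {a : Lim C G} (ha : InStage d a) : IsStrongAt d (LinearMap.mulLeft C a) :=
  ⟨fun _ hx => ha.mul hx, fun _ _ _ hF hx => hx.mul_left a ⟨d, fun i => ha.mul (hF i)⟩⟩

theorem smul (h : IsStrongAt d φ) (c : C) : IsStrongAt d (c • φ) := by
  have : c • φ = LinearMap.mulLeft C (algebraMap C (Lim C G) c) * φ := by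
    ext x; simp [Algebra.smul_def]
  exact this ▸ (mulLeft (InStage.algebraMap c)).mul h

theorem summableAt {κ : Type u} (h : IsStrongAt d φ) {F : κ → Lim C G} (hF : SummableAt d F) :
    SummableAt d fun k => φ (F k) := by
  obtain ⟨hd, x, hx⟩ := hF
  exact ⟨fun k => h.1 _ (hd k), _, h.2 κ F x hd hx⟩

end IsStrongAt

theorem IsContracting.le {φ : Lim C G →ₗ[C] Lim C G} (hφ : IsContracting φ) (x : Lim C G) :
    val x ≤ val (φ x) := by
  rcases eq_or_ne x 0 with rfl | hx
  · rw [map_zero]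
  · exact (hφ x hx).le

theorem IsContracting.lt_of_le {φ : Lim C G →ₗ[C] Lim C G} (hφ : IsContracting φ) {γ : Γ}
    {x : Lim C G} (hx : (γ : WithTop Γ) ≤ val x) : (γ : WithTop Γ) < val (φ x) := by
  rcases eq_or_ne x 0 with rfl | h0
  · rw [map_zero, val_zero]
    exact WithTop.coe_lt_top γ
  · exact hx.trans_lt (hφ x h0)

theorem IsContracting.pow_lt {φ : Lim C G →ₗ[C] Lim C G} (hφ : IsContracting φ) {γ : Γ}
    {x : Lim C G} (hx : (γ : WithTop Γ) ≤ val x) {n : ℕ} (hn : n ≠ 0) :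
    (γ : WithTop Γ) < val ((φ ^ n) x) := by
  obtain ⟨n, rfl⟩ := Nat.exists_eq_succ_of_ne_zero hn
  induction n with
  | zero => simpa using hφ.lt_of_le hx
  | succ n ih =>
    rw [pow_succ', Module.End.mul_apply]
    exact hφ.lt_of_le (ih (by simp)).le

/-- The orbit of a summable family under a contracting strongly linear operator is summable: it is
the fixed point of the contracting operation on families that shifts the orbit by one and puts the
initial family in front. -/
theorem SummableAt.orbit {ι : Type u} {d : D} {F : ι → Lim C G} (hF : SummableAt d F)
    {φ : Lim C G →ₗ[C] Lim C G} (hφ : IsStrongAt d φ) (hc : IsContracting φ) :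
    SummableAt d fun p : ι × ℕ => (φ ^ p.2) (F p.1) := by
  let Φ : (ι × ℕ → Lim C G) → ι × ℕ → Lim C G := fun Y p =>
    Nat.casesOn p.2 (F p.1) fun n => φ (Y (p.1, n))
  obtain ⟨Y, hY, hfix⟩ := SummableAt.exists_fixedPoint (d := d) Φ (by
    intro Y hY
    have h1 : SummableAt d fun p : ι × ℕ => (Nat.casesOn p.2 (F p.1) fun _ => 0 : Lim C G) :=
      hF.extend (e := fun i => (i, 0)) (fun i j h => (Prod.mk.inj h).1) (fun _ => rfl) (by
        rintro ⟨i, _ | n⟩ h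
        · exact absurd ⟨i, rfl⟩ h
        · rfl)
    have h2 : SummableAt d fun p : ι × ℕ =>
        (Nat.casesOn p.2 0 fun n => φ (Y (p.1, n)) : Lim C G) :=
      (hφ.summableAt hY).extend (e := fun p => (p.1, p.2 + 1))
        (fun p q h => Prod.ext (Prod.mk.inj h).1 (Nat.succ.inj (Prod.mk.inj h).2))
        (fun _ => rfl) (by
          rintro ⟨i, _ | n⟩ h
          · rfl
          · exact absurd ⟨(i, n), rfl⟩ h)
    convert h1.add h2 using 2 with p
    obtain ⟨i, _ | n⟩ := p <;> simp [Φ]) (by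
    rintro Y Z - - γ h ⟨i, _ | n⟩
    · change _ < val (F i - F i)
      rw [sub_self, val_zero]
      exact WithTop.coe_lt_top γ
    · change _ < val (φ (Y (i, n)) - φ (Z (i, n)))
      rw [← map_sub]
      exact hc.lt_of_le (h (i, n)))
  have : ∀ i n, Y (i, n) = (φ ^ n) (F i) := by
    intro i n
    induction n with
    | zero => rw [← hfix]; simp [Φ]
    | succ n ih =>
      rw [← hfix, pow_succ', Module.End.mul_apply, ← ih]
  convert hY using 2 with p
  exact (this p.1 p.2).symm

/-! ### Exponentials of contracting operators -/

theorem IsContracting.exists_hasStrongSum {d : D} {φ : Lim C G →ₗ[C] Lim C G}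
    (hφ : IsStrongAt d φ) (hc : IsContracting φ) {x : Lim C G} (hx : InStage d x) :
    ∃ y, HasStrongSum (fun n : ℕ => ((n.factorial : C)⁻¹) • (φ ^ n) x) y :=
  ((((SummableAt.of_inStage hx).orbit hφ hc).comp_injective
    (e := fun n : ℕ => (PUnit.unit, n)) fun _ _ h => (Prod.mk.inj h).2).smul
      fun n => (n.factorial : C)⁻¹).2

/-- The operator `exp φ`, when all the exponential series are summable. -/
noncomputable def expMap (φ : Lim C G →ₗ[C] Lim C G)
    (h : ∀ x, ∃ y, HasStrongSum (fun n : ℕ => ((n.factorial : C)⁻¹) • (φ ^ n) x) y) :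
    Lim C G →ₗ[C] Lim C G where
  toFun x := (h x).choose
  map_add' x y := by
    refine (h (x + y)).choose_spec.unique ?_
    obtain ⟨d, hd⟩ := (h (x + y)).choose_spec.1
    convert (h x).choose_spec.add (h y).choose_spec ⟨d, fun n => ?_⟩ using 2 with n
    · rw [map_add, smul_add]
    · rw [← smul_add, ← map_add]
      exact hd n
  map_smul' c x := by
    refine (h (c • x)).choose_spec.unique ?_
    obtain ⟨d, hd⟩ := (h (c • x)).choose_spec.1
    have hterm : ∀ n : ℕ, ((n.factorial : C)⁻¹) • (φ ^ n) (c • x) =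
        algebraMap C (Lim C G) c * ((n.factorial : C)⁻¹) • (φ ^ n) x := fun n => by
      rw [← Algebra.smul_def, map_smul, smul_comm]
    simp only [hterm] at hd ⊢
    rw [RingHom.id_apply, Algebra.smul_def]
    exact (h x).choose_spec.mul_left (algebraMap C (Lim C G) c) ⟨d, hd⟩

theorem isExp_expMap (φ : Lim C G →ₗ[C] Lim C G)
    (h : ∀ x, ∃ y, HasStrongSum (fun n : ℕ => ((n.factorial : C)⁻¹) • (φ ^ n) x) y) :
    IsExp φ (expMap φ h) := fun x => (h x).choose_spec

namespace IsExp

variable {φ σ : Lim C G →ₗ[C] Lim C G}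

theorem isStrongAt (hσ : IsExp φ σ) {d : D} (hφ : IsStrongAt d φ) (hc : IsContracting φ) :
    IsStrongAt d σ := by
  have hst : ∀ x, InStage d x → ∀ n : ℕ, InStage d (((n.factorial : C)⁻¹) • (φ ^ n) x) :=
    fun x hx n => ((hφ.pow n).1 x hx).smul _
  refine ⟨fun x hx => (hσ x).inStage (hst x hx), fun ι F x hF hx => ?_⟩
  obtain ⟨-, t, ht⟩ := (SummableAt.orbit ⟨hF, x, hx⟩ hφ hc).smul
    fun p => (p.2.factorial : C)⁻¹
  have hrow := ht.sum_rows fun i => hσ (F i)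
  have hcol := ht.sum_columns (E := fun n => ((n.factorial : C)⁻¹) • (φ ^ n) x)
    fun n => ((hφ.pow n).smul ((n.factorial : C)⁻¹)).2 ι F x hF hx
  rwa [← hcol.unique (hσ x)]

/-- `exp φ - 1` is contracting if `φ` is. -/
theorem isContracting_sub_one (hσ : IsExp φ σ) (hc : IsContracting φ) :
    IsContracting (σ - 1) := by
  intro x hx
  obtain ⟨γ, hγ⟩ := exists_val_eq hx
  rw [Prec, hγ, LinearMap.sub_apply, Module.End.one_apply]
  rcases eq_or_ne (σ x - x) 0 with h0 | h0
  · rw [h0, val_zero]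
    exact WithTop.coe_lt_top γ
  · obtain ⟨n, hn, -, hle⟩ := (hσ x).exists_val_le {0} (by simpa using h0)
    have : σ x - ∑ k ∈ ({0} : Finset ℕ), ((k.factorial : C)⁻¹) • (φ ^ k) x = σ x - x := by simp
    rw [this] at hle
    exact ((hc.pow_lt hγ.ge (by simpa using hn)).trans_le (val_le_smul _ _)).trans_le hle

/-- Summable families have summable preimages under `exp φ`. -/
theorem exists_preimage_family (hσ : IsExp φ σ) {d : D} (hφ : IsStrongAt d φ)
    (hc : IsContracting φ) {κ : Type u} {F : κ → Lim C G} (hF : SummableAt d F) :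
    ∃ Y : κ → Lim C G, SummableAt d Y ∧ ∀ k, σ (Y k) = F k := by
  have hs := (hσ.isStrongAt hφ hc).sub (IsStrongAt.one (d := d))
  obtain ⟨Y, hY, hfix⟩ := SummableAt.exists_fixedPoint (d := d)
    (fun Y k => F k - (σ - 1) (Y k)) (fun Y hY => hF.sub (hs.summableAt hY)) (by
      intro Y Z _ _ γ h k
      rw [sub_sub_sub_cancel_left, ← map_sub, ← val_neg, ← map_neg, neg_sub]
      exact (hσ.isContracting_sub_one hc).lt_of_le (h k))
  refine ⟨Y, hY, fun k => ?_⟩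
  have := congrFun hfix k
  simp only [LinearMap.sub_apply, Module.End.one_apply] at this
  rw [sub_eq_iff_eq_add] at this
  rw [this]; abel

theorem injective (hσ : IsExp φ σ) (hc : IsContracting φ) : Function.Injective σ := by
  rw [injective_iff_map_eq_zero]
  intro x hx
  by_contra h0
  have := hσ.isContracting_sub_one hc x h0
  simp [Prec, hx, val_neg] at this

end IsExp

section Leibniz

variable [CharZero C]

/-- Iterates of an operator that acts on the values of a bilinear operation by the Leibniz rule. -/
theorem inv_factorial_smul_pow_bilin {M : Type*} [AddCommGroup M] [Module C M]
    (m : M →ₗ[C] M →ₗ[C] M) (α β φ : Module.End C M)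
    (hm : ∀ a b, φ (m a b) = m (α a) b + m a (β b)) (n : ℕ) (a b : M) :
    (n.factorial : C)⁻¹ • (φ ^ n) (m a b) =
      ∑ p ∈ Finset.HasAntidiagonal.antidiagonal n,
        m ((p.1.factorial : C)⁻¹ • (α ^ p.1) a) ((p.2.factorial : C)⁻¹ • (β ^ p.2) b) := by
  have key : (φ ^ n) (m a b) = ∑ p ∈ Finset.HasAntidiagonal.antidiagonal n,
      n.choose p.1 • m ((α ^ p.1) a) ((β ^ p.2) b) := by
    induction n with
    | zero => simp
    | succ n ih =>
      rw [Finset.sum_antidiagonal_choose_succ_nsmul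
        (fun i j => m ((α ^ i) a) ((β ^ j) b)) n, pow_succ', Module.End.mul_apply, ih, map_sum]
      rw [add_comm, ← Finset.sum_add_distrib]
      refine Finset.sum_congr rfl fun p hp => ?_
      rw [n.choose_symm_of_eq_add (Finset.HasAntidiagonal.mem_antidiagonal.1 hp).symm, map_nsmul,
        hm, smul_add, pow_succ', pow_succ']
      rfl
  rw [key, Finset.smul_sum]
  refine Finset.sum_congr rfl fun p hp => ?_
  rw [Finset.HasAntidiagonal.mem_antidiagonal] at hp
  subst hp
  rw [map_smul (m _), map_smul m, LinearMap.smul_apply, smul_smul,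
    ← Nat.cast_smul_eq_nsmul C, smul_smul, Nat.cast_add_choose]
  congr 1
  have := Nat.cast_ne_zero (R := C) |>.2 (p.1 + p.2).factorial_ne_zero
  have := Nat.cast_ne_zero (R := C) |>.2 p.1.factorial_ne_zero
  have := Nat.cast_ne_zero (R := C) |>.2 p.2.factorial_ne_zero
  field_simp

end Leibniz

end

section

variable {Γ : Type u} [AddCommGroup Γ] [LinearOrder Γ] [IsOrderedAddMonoid Γ]
variable {C : Type v} [Field C] {D : Type w} {G : D → AddSubgroup Γ}

/-! ### The asymptotic couple of an H-asymptotic derivation -/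

theorem lt_val_mul {x y : Lim C G} {α β : Γ} (hx : val x = α) (hy : (β : WithTop Γ) < val y) :
    ((α + β : Γ) : WithTop Γ) < val (x * y) := by
  rw [val_mul, hx, WithTop.coe_add]
  exact WithTop.add_lt_add_left WithTop.coe_ne_top hy

/-- `∂` is an H-asymptotic derivation with kernel `C`, and every element of `Γ` is a valuation. -/
structure IsHDerivation (der : Derivation C (Lim C G) (Lim C G)) : Prop where
  union : ∀ γ : Γ, ∃ d, γ ∈ G d
  ker : ∀ x, der x = 0 ↔ ∃ c : C, x = algebraMap C (Lim C G) c
  asymp : IsHAsymptotic der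

open Classical in
/-- The function `γ ↦ γ†` on `Γ ∖ {0}`, computed with an arbitrary element of valuation `γ`. -/
noncomputable def psi (der : Derivation C (Lim C G) (Lim C G)) (γ : Γ) : Γ :=
  if h : ∃ x : Lim C G, val x = γ then (Lim.series (der h.choose / h.choose)).order else 0

namespace IsHDerivation

variable {der : Derivation C (Lim C G) (Lim C G)} (hD : IsHDerivation der)
include hD

theorem exists_val (γ : Γ) : ∃ x : Lim C G, val x = γ := by
  obtain ⟨d, hd⟩ := hD.union γ
  obtain ⟨x, -, -, hx⟩ := exists_monomial (C := C) hd
  exact ⟨x, hx⟩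

theorem der_ne_zero {x : Lim C G} {γ : Γ} (hx : val x = γ) (hγ : γ ≠ 0) : der x ≠ 0 := by
  intro h
  obtain ⟨c, rfl⟩ := (hD.ker x).1 h
  have hc : c ≠ 0 := by
    rintro rfl
    rw [map_zero, val_zero] at hx
    exact WithTop.top_ne_coe hx
  rw [val_algebraMap hc] at hx
  exact hγ (WithTop.coe_injective hx).symm

theorem val_div_eq {x y : Lim C G} {γ : Γ} (hx : val x = γ) (hy : val y = γ) (hγ : γ ≠ 0) :
    val (der x / x) = val (der y / y) := by
  -- positive valuations first; the general case by passing to inverses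
  have key : ∀ (x y : Lim C G) (γ : Γ), val x = γ → val y = γ → 0 < γ →
      val (der x / x) = val (der y / y) := by
    intro x y γ hx hy hγ
    have hp : ∀ z : Lim C G, val z = γ → Prec z 1 := fun z hz => by
      rw [Prec, hz, val_one]
      exact_mod_cast hγ
    have h1 := (hD.asymp x y (ne_zero_of_val hx) (ne_zero_of_val hy) (hp x hx) (hp y hy)).1
    have h2 := (hD.asymp y x (ne_zero_of_val hy) (ne_zero_of_val hx) (hp y hy) (hp x hx)).1
    simp only [Prec, hx, hy, lt_self_iff_false, false_iff, not_lt] at h1 h2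
    rw [div_eq_mul_inv, div_eq_mul_inv, val_mul, val_mul, val_inv hx, val_inv hy,
      le_antisymm h1 h2]
  have hinv : ∀ x : Lim C G, x ≠ 0 → der x⁻¹ / x⁻¹ = -(der x / x) := by
    intro x hx
    rw [Derivation.leibniz_inv, smul_eq_mul]
    field_simp
  rcases lt_or_gt_of_ne hγ with h | h
  · have h1 := key _ _ _ (val_inv hx) (val_inv hy) (by grind)
    rwa [hinv _ (ne_zero_of_val hx), hinv _ (ne_zero_of_val hy), val_neg, val_neg] at h1
  · exact key x y γ hx hy h

theorem val_dagger {x : Lim C G} {γ : Γ} (hx : val x = γ) (hγ : γ ≠ 0) :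
    val (der x / x) = psi der γ := by
  have h : ∃ x : Lim C G, val x = γ := ⟨x, hx⟩
  rw [psi, dif_pos h]
  have hne : der h.choose / h.choose ≠ 0 :=
    div_ne_zero (hD.der_ne_zero h.choose_spec hγ) (ne_zero_of_val h.choose_spec)
  obtain ⟨δ, hδ⟩ := exists_val_eq hne
  rw [hD.val_div_eq hx h.choose_spec hγ, order_series hδ, hδ]

theorem val_der {x : Lim C G} {γ : Γ} (hx : val x = γ) (hγ : γ ≠ 0) :
    val (der x) = ((γ + psi der γ : Γ) : WithTop Γ) := by
  have h : der x = x * (der x / x) := by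
    have := ne_zero_of_val hx
    field_simp
  rw [h, val_mul, hD.val_dagger hx hγ, hx, WithTop.coe_add]

theorem isHCouple [CharZero C] : IsHCouple (psi der) := by
  have hp : ∀ (z : Lim C G) (γ : Γ), val z = γ → 0 < γ → Prec z 1 := fun z γ hz hγ => by
    rw [Prec, hz, val_one]
    exact_mod_cast hγ
  refine ⟨fun α β hα hαβ => ?_, fun α β hα hαβ => ?_, fun α => ?_, fun α => ?_⟩
  · rcases hαβ.eq_or_lt with rfl | hlt
    · rfl
    · obtain ⟨x, hx⟩ := hD.exists_val α
      obtain ⟨y, hy⟩ := hD.exists_val β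
      have := (hD.asymp y x (ne_zero_of_val hy) (ne_zero_of_val hx) (hp y β hy (hα.trans hlt))
        (hp x α hx hα)).2 (by rw [Prec, hx, hy]; exact_mod_cast hlt)
      rw [hD.val_dagger hx hα.ne', hD.val_dagger hy (hα.trans hlt).ne'] at this
      exact_mod_cast this
  · obtain ⟨x, hx⟩ := hD.exists_val α
    obtain ⟨y, hy⟩ := hD.exists_val β
    have := (hD.asymp y x (ne_zero_of_val hy) (ne_zero_of_val hx) (hp y β hy (hα.trans hαβ))
      (hp x α hx hα)).1.1 (by rw [Prec, hx, hy]; exact_mod_cast hαβ)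
    rw [Prec, hD.val_der hx hα.ne', hD.val_der hy (hα.trans hαβ).ne'] at this
    exact_mod_cast this
  · rcases eq_or_ne α 0 with rfl | hα
    · rw [neg_zero]
    · obtain ⟨x, hx⟩ := hD.exists_val α
      have h1 := hD.val_dagger (val_inv hx) (neg_ne_zero.2 hα)
      have h2 : der x⁻¹ / x⁻¹ = -(der x / x) := by
        have := ne_zero_of_val hx
        rw [Derivation.leibniz_inv, smul_eq_mul]
        field_simp
      rw [h2, val_neg, hD.val_dagger hx hα] at h1
      exact (WithTop.coe_injective h1).symm
  · rcases eq_or_ne α 0 with rfl | hα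
    · rw [add_zero]
    · obtain ⟨x, hx⟩ := hD.exists_val α
      have hxx : val (x * x) = ((α + α : Γ) : WithTop Γ) := by rw [val_mul, hx, WithTop.coe_add]
      have h1 := hD.val_dagger hxx (by grind)
      have h2 : der (x * x) / (x * x) = (2 : C) • (der x / x) := by
        have := ne_zero_of_val hx
        rw [Derivation.leibniz, smul_eq_mul, ofNat_smul_eq_nsmul, two_nsmul]
        field_simp
      rw [h2, val_smul two_ne_zero, hD.val_dagger hx hα] at h1
      exact (WithTop.coe_injective h1).symm

theorem psi_mem {d : D} (hreg : ∀ x, InStage d x → InStage d (der x)) {γ : Γ} (hγ : γ ∈ G d)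
    (h0 : γ ≠ 0) : psi der γ ∈ G d := by
  obtain ⟨x, -, hx, hv⟩ := exists_monomial (C := C) hγ
  have := (hreg x hx).val_mem (hD.val_der hv h0)
  simpa using (G d).sub_mem this hγ

theorem psi_mem_psiSet {γ : Γ} (hγ : 0 < γ) : psi der γ ∈ psiSet der := by
  obtain ⟨x, hx⟩ := hD.exists_val γ
  exact ⟨γ, hγ, hγ.ne', x, hx, hD.val_dagger hx hγ.ne'⟩

theorem isPrimeValue {γ : Γ} (hγ : γ ≠ 0) : IsPrimeValue der γ (γ + psi der γ) := by
  obtain ⟨x, hx⟩ := hD.exists_val γ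
  exact ⟨hγ, x, hx, hD.val_der hx hγ⟩

/-- A nonconstant bounded element has the same derivative as an infinitesimal one. -/
theorem exists_der_eq {x : Lim C G} (hx : 0 ≤ val x) (h : der x ≠ 0) :
    ∃ δ : Γ, 0 < δ ∧ val (der x) = ((δ + psi der δ : Γ) : WithTop Γ) := by
  obtain ⟨c, hc⟩ := exists_lt_val_sub hx
  have h1 : der (x - algebraMap C (Lim C G) c) = der x := by
    rw [map_sub, Derivation.map_algebraMap, sub_zero]
  obtain ⟨δ, hδ⟩ := exists_val_eq (x := x - algebraMap C (Lim C G) c) (by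
    intro h0
    rw [h0, map_zero] at h1
    exact h h1.symm)
  rw [hδ] at hc
  have hδ0 : 0 < δ := by exact_mod_cast hc
  exact ⟨δ, hδ0, by rw [← h1, hD.val_der hδ hδ0.ne']⟩

theorem psi_lt_val_der [CharZero C] {x : Lim C G} (hx : 0 ≤ val x) {γ : Γ} (hγ : γ ≠ 0) :
    ((psi der γ : Γ) : WithTop Γ) < val (der x) := by
  by_cases h : der x = 0
  · rw [h, val_zero]
    exact WithTop.coe_lt_top _
  · obtain ⟨δ, hδ, hv⟩ := hD.exists_der_eq hx h
    rw [hv]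
    exact_mod_cast hD.isHCouple.lt hγ hδ

/-! ### The contractive hull -/

/-- `f ∂` is contracting if and only if `v(f) + Ψ > 0`. -/
theorem mem_cont_iff {f : Lim C G} :
    f ∈ Cont der ↔ ∀ γ : Γ, γ ≠ 0 → 0 < val f + ((psi der γ : Γ) : WithTop Γ) := by
  constructor
  · intro h γ hγ
    obtain ⟨x, hx⟩ := hD.exists_val γ
    have h1 : val x < val (f * der x) := h x (ne_zero_of_val hx)
    rw [val_mul, hD.val_der hx hγ, hx] at h1
    rcases eq_or_ne f 0 with rfl | hf
    · simp [val_zero]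
    · obtain ⟨η, hη⟩ := exists_val_eq hf
      rw [hη] at h1 ⊢
      norm_cast at h1 ⊢
      grind
  · intro h x hx
    change val x < val (f * der x)
    rcases eq_or_ne f 0 with rfl | hf
    · rw [zero_mul, val_zero]
      exact lt_top_iff_ne_top.2 (val_eq_top.not.2 hx)
    obtain ⟨η, hη⟩ := exists_val_eq hf
    obtain ⟨γ, hγ⟩ := exists_val_eq hx
    have h' : ∀ γ : Γ, γ ≠ 0 → 0 < η + psi der γ := fun γ hγ => by
      have := h γ hγ
      rw [hη] at this
      exact_mod_cast this
    by_cases hdx : der x = 0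
    · rw [hdx, mul_zero, val_zero]
      exact lt_top_iff_ne_top.2 (val_eq_top.not.2 hx)
    rcases eq_or_ne γ 0 with rfl | hγ0
    · obtain ⟨δ, hδ, hv⟩ := hD.exists_der_eq hγ.ge hdx
      rw [val_mul, hv, hη, hγ]
      have := h' δ hδ.ne'
      norm_cast
      grind
    · rw [val_mul, hD.val_der hγ hγ0, hη, hγ]
      have := h' γ hγ0
      norm_cast
      grind

theorem mem_cont_iff_of_val {f : Lim C G} {η : Γ} (hη : val f = η) :
    f ∈ Cont der ↔ ∀ γ : Γ, γ ≠ 0 → 0 < η + psi der γ := by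
  rw [hD.mem_cont_iff, hη]
  norm_cast

theorem mem_cont_of_min_le {x y z : Lim C G} (hx : x ∈ Cont der) (hy : y ∈ Cont der)
    (hz : min (val x) (val y) ≤ val z) : z ∈ Cont der := by
  rw [hD.mem_cont_iff] at *
  intro γ hγ
  refine lt_of_lt_of_le ?_ (add_le_add_left hz _)
  rcases le_total (val x) (val y) with h | h
  · rw [min_eq_left h]; exact hx γ hγ
  · rw [min_eq_right h]; exact hy γ hγ

theorem pos_val_mul_der {g u : Lim C G} (hg : g ∈ Cont der) (hu : g * u ∈ Cont der) :
    0 < val (g * der u) := by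
  by_cases h0 : g * der u = 0
  · rw [h0, val_zero]
    exact WithTop.coe_lt_top 0
  obtain ⟨η, hη⟩ := exists_val_eq (left_ne_zero_of_mul h0)
  have hu0 : u ≠ 0 := by
    rintro rfl
    simp at h0
  obtain ⟨γ, hγ⟩ := exists_val_eq hu0
  rcases eq_or_ne γ 0 with rfl | hγ0
  · obtain ⟨δ, hδ, hv⟩ := hD.exists_der_eq hγ.ge (right_ne_zero_of_mul h0)
    have := (hD.mem_cont_iff_of_val hη).1 hg δ hδ.ne'
    rw [val_mul, hv, hη]
    norm_cast
    grind
  · have hgu : val (g * u) = ((η + γ : Γ) : WithTop Γ) := by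
      rw [val_mul, hη, hγ, WithTop.coe_add]
    have := (hD.mem_cont_iff_of_val hgu).1 hu γ hγ0
    rw [val_mul, hD.val_der hγ hγ0, hη]
    norm_cast
    grind

end IsHDerivation

/-! ### The adjoint action -/

/-- The operator `ad_{u g ∂}` on derivations `w g ∂`: one has `[u g ∂, w g ∂] = (adMap u w) g ∂`. -/
noncomputable def adMap (der : Derivation C (Lim C G) (Lim C G)) (g u : Lim C G) :
    Lim C G →ₗ[C] Lim C G :=
  LinearMap.mulLeft C (g * u) * der.toLinearMap - LinearMap.mulLeft C (g * der u)

theorem adMap_apply (der : Derivation C (Lim C G) (Lim C G)) (g u w : Lim C G) :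
    adMap der g u w = g * u * der w - g * der u * w := rfl

theorem adMap_sub_left (der : Derivation C (Lim C G) (Lim C G)) (g u u' w : Lim C G) :
    adMap der g (u - u') w = adMap der g u w - adMap der g u' w := by
  simp only [adMap_apply, map_sub]
  ring

theorem adMap_one (der : Derivation C (Lim C G) (Lim C G)) (g u : Lim C G) :
    adMap der g u 1 = -(g * der u) := by
  rw [adMap_apply, Derivation.map_one_eq_zero]
  ring

theorem isStrongAt_adMap {der : Derivation C (Lim C G) (Lim C G)} {d : D}
    (hd : IsStrongAt d der.toLinearMap) {g u : Lim C G} (hg : InStage d g) (hu : InStage d u) :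
    IsStrongAt d (adMap der g u) :=
  ((IsStrongAt.mulLeft (hg.mul hu)).mul hd).sub (IsStrongAt.mulLeft (hg.mul (hd.1 u hu)))

namespace IsHDerivation

variable {der : Derivation C (Lim C G) (Lim C G)} (hD : IsHDerivation der)
include hD

theorem isContracting_adMap {g u : Lim C G} (hg : g ∈ Cont der) (hu : g * u ∈ Cont der) :
    IsContracting (adMap der g u) := by
  intro w hw
  obtain ⟨γ, hγ⟩ := exists_val_eq hw
  rw [Prec, adMap_apply]
  refine lt_val_sub (hu w hw) ?_
  rw [mul_comm, hγ]
  have := lt_val_mul hγ (β := 0) (hD.pos_val_mul_der hg hu)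
  rwa [add_zero] at this

/-- On infinitesimals `w`, the bracket with `Δ` is smaller than `g ∂ Δ`. -/
theorem val_lt_val_adMap [CharZero C] {g Δ w : Lim C G} (hg : g ≠ 0) {η : Γ}
    (hΔ : val Δ = η) (hη : η ≠ 0) (hw : 0 < val w) : val (g * der Δ) < val (adMap der g Δ w) := by
  obtain ⟨γ, hγ⟩ := exists_val_eq hg
  have h1 : val (g * der Δ) = ((γ + (η + psi der η) : Γ) : WithTop Γ) := by
    rw [val_mul, hγ, hD.val_der hΔ hη, ← WithTop.coe_add]
  have h2 : val (g * Δ) = ((γ + η : Γ) : WithTop Γ) := by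
    rw [val_mul, hγ, hΔ, ← WithTop.coe_add]
  rw [adMap_apply]
  refine lt_val_sub ?_ ?_
  · rw [h1, ← add_assoc]
    exact lt_val_mul h2 (hD.psi_lt_val_der hw.le hη)
  · have := lt_val_mul h1 (β := 0) hw
    rwa [add_zero, ← h1] at this

end IsHDerivation

end

section

variable {Γ : Type u} [AddCommGroup Γ] [LinearOrder Γ] [IsOrderedAddMonoid Γ]
variable {C : Type v} [Field C] {D : Type w} {G : D → AddSubgroup Γ}

/-! ### The conjugation cocycle `exp (ad (u g ∂)) 1` -/

open Classical in
/-- The element `E(u)` with `exp (ad (u g ∂)) (g ∂) = E(u) g ∂`, that is, the sum of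
`(adMap u)ⁿ 1 / n!`, when this family is summable; otherwise it is `0`. -/
noncomputable def expAd (der : Derivation C (Lim C G) (Lim C G)) (g u : Lim C G) : Lim C G :=
  if h : ∃ y, HasStrongSum (fun n : ℕ => ((n.factorial : C)⁻¹) • (adMap der g u ^ n) 1) y then
    h.choose else 0

/-- The elements `u` of `𝕊_d` without constant term for which `g u ∂` is contracting. Differences of
such elements have nonzero valuation, so `v(Δ)` determines `v(Δ′)` for them. -/
def admissible (der : Derivation C (Lim C G) (Lim C G)) (g : Lim C G) (d : D) : Set (Lim C G) :=
  {u | InStage d u ∧ (Lim.series u).coeff 0 = 0 ∧ g * u ∈ Cont der}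

theorem admissible_mono [Preorder D] (hG : Monotone G)
    {der : Derivation C (Lim C G) (Lim C G)} {g u : Lim C G} {d e : D} (hde : d ≤ e)
    (hu : u ∈ admissible der g d) : u ∈ admissible der g e :=
  ⟨hu.1.mono hG hde, hu.2⟩

theorem val_ne_zero_of_coeff {x : Lim C G} (hx : (Lim.series x).coeff 0 = 0) {η : Γ}
    (h : val x = η) : η ≠ 0 := by
  rintro rfl
  exact HahnSeries.coeff_orderTop_ne h hx

/-- `z` is zero, or `v(z) ≥ γ + α′` for some `α > 0` in `G e`. -/
def IsDeep (der : Derivation C (Lim C G) (Lim C G)) (e : D) (γ : Γ) (z : Lim C G) : Prop :=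
  z ≠ 0 → ∃ α ∈ G e, 0 < α ∧ ((γ + (α + psi der α) : Γ) : WithTop Γ) ≤ val z

namespace IsDeep

variable {der : Derivation C (Lim C G) (Lim C G)} {e : D} {γ : Γ} {x y : Lim C G}

theorem of_min_le (hx : IsDeep der e γ x) (hy : IsDeep der e γ y) {z : Lim C G}
    (hz : min (val x) (val y) ≤ val z) : IsDeep der e γ z := by
  intro h
  rcases le_total (val x) (val y) with hxy | hxy
  · rw [min_eq_left hxy] at hz
    obtain ⟨α, h1, h2, h3⟩ := hx fun h0 => h (by
      rw [h0, val_zero, top_le_iff] at hz; exact val_eq_top.1 hz)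
    exact ⟨α, h1, h2, h3.trans hz⟩
  · rw [min_eq_right hxy] at hz
    obtain ⟨α, h1, h2, h3⟩ := hy fun h0 => h (by
      rw [h0, val_zero, top_le_iff] at hz; exact val_eq_top.1 hz)
    exact ⟨α, h1, h2, h3.trans hz⟩

theorem of_le (hx : IsDeep der e γ x) (h : val x ≤ val y) : IsDeep der e γ y :=
  hx.of_min_le hx (by rwa [min_self])

theorem add (hx : IsDeep der e γ x) (hy : IsDeep der e γ y) : IsDeep der e γ (x + y) :=
  hx.of_min_le hy (min_val_le_add x y)

theorem sub (hx : IsDeep der e γ x) (hy : IsDeep der e γ y) : IsDeep der e γ (x - y) :=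
  hx.of_min_le hy (min_val_le_sub x y)

theorem neg (hx : IsDeep der e γ x) : IsDeep der e γ (-x) := hx.of_le (val_neg x).ge

end IsDeep

/-- The recursion for the differences of the terms of two exponential series. -/
theorem adMap_pow_succ_sub (der : Derivation C (Lim C G) (Lim C G)) (g u₁ u₂ : Lim C G) (n : ℕ) :
    (adMap der g u₁ ^ (n + 1)) 1 - (adMap der g u₂ ^ (n + 1)) 1 =
      adMap der g u₁ ((adMap der g u₁ ^ n) 1 - (adMap der g u₂ ^ n) 1) +
        adMap der g (u₁ - u₂) ((adMap der g u₂ ^ n) 1) := by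
  rw [adMap_sub_left, map_sub, pow_succ', pow_succ', Module.End.mul_apply, Module.End.mul_apply]
  abel

theorem adMap_pow_one_sub (der : Derivation C (Lim C G) (Lim C G)) (g u₁ u₂ : Lim C G) :
    (adMap der g u₁ ^ 1) 1 - (adMap der g u₂ ^ 1) 1 = -(g * der (u₁ - u₂)) := by
  rw [pow_one, pow_one, adMap_one, adMap_one, map_sub]
  ring

section

variable {der : Derivation C (Lim C G) (Lim C G)} {g : Lim C G}

theorem hasStrongSum_expAd
    (hD : IsHDerivation der) (hreg : IsRegular der.toLinearMap) (hg : g ∈ Cont der)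
    {d : D} (hgd : InStage d g) {u : Lim C G}
    (hu : u ∈ admissible der g d) :
    HasStrongSum (fun n : ℕ => ((n.factorial : C)⁻¹) • (adMap der g u ^ n) 1)
      (expAd der g u) := by
  have h := (hD.isContracting_adMap hg hu.2.2).exists_hasStrongSum
    (isStrongAt_adMap (hreg d) hgd hu.1) InStage.one
  rw [expAd, dif_pos h]
  exact h.choose_spec

theorem inStage_adMap_pow_one
    (hreg : IsRegular der.toLinearMap)
    {d : D} (hgd : InStage d g) {u : Lim C G}
    (hu : u ∈ admissible der g d) (n : ℕ) : InStage d ((adMap der g u ^ n) 1) :=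
  ((isStrongAt_adMap (hreg d) hgd hu.1).pow n).1 _ InStage.one

theorem inStage_expAd
    (hD : IsHDerivation der) (hreg : IsRegular der.toLinearMap) (hg : g ∈ Cont der)
    {d : D} (hgd : InStage d g) {u : Lim C G}
    (hu : u ∈ admissible der g d) : InStage d (expAd der g u) :=
  (hasStrongSum_expAd hD hreg hg hgd hu).inStage fun n =>
    (inStage_adMap_pow_one hreg hgd hu n).smul _

theorem expAd_zero
    (hD : IsHDerivation der) (hreg : IsRegular der.toLinearMap) (hg : g ∈ Cont der)
    {d : D} (hgd : InStage d g) (h0 : (0 : Lim C G) ∈ admissible der g d) :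
    expAd der g 0 = 1 := by
  by_contra hne
  have hs := hasStrongSum_expAd hD hreg hg hgd h0
  obtain ⟨n, hn, hn0, -⟩ := hs.exists_val_le {0} (by simpa [sub_eq_zero] using hne)
  refine hn0 ?_
  have : adMap der g 0 = 0 := by
    ext w
    simp [adMap_apply]
  rw [this, zero_pow (by simpa using hn)]
  simp

/-- The nonlinear part of `E(u₁) - E(u₂)` is at most as large as the difference of some terms of
order at least two. -/
theorem exists_val_le_expAd_sub
    (hD : IsHDerivation der) (hreg : IsRegular der.toLinearMap) (hg : g ∈ Cont der)
    {d : D} (hgd : InStage d g) {u₁ u₂ : Lim C G}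
    (h₁ : u₁ ∈ admissible der g d) (h₂ : u₂ ∈ admissible der g d)
    (hne : expAd der g u₁ - expAd der g u₂ + g * der (u₁ - u₂) ≠ 0) :
    ∃ n : ℕ, val ((adMap der g u₁ ^ (n + 2)) 1 - (adMap der g u₂ ^ (n + 2)) 1) ≤
      val (expAd der g u₁ - expAd der g u₂ + g * der (u₁ - u₂)) := by
  have hst : ∀ {u}, u ∈ admissible der g d → ∀ n, InStage d ((adMap der g u ^ n) 1) :=
    fun hu n => inStage_adMap_pow_one hreg hgd hu n
  have hs := (hasStrongSum_expAd hD hreg hg hgd h₁).sub (hasStrongSum_expAd hD hreg hg hgd h₂)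
    ⟨d, fun n => ((hst h₁ n).smul _).sub ((hst h₂ n).smul _)⟩
  have hlow : expAd der g u₁ - expAd der g u₂ - ∑ n ∈ Finset.range 2,
      (((n.factorial : C)⁻¹) • (adMap der g u₁ ^ n) 1 -
        ((n.factorial : C)⁻¹) • (adMap der g u₂ ^ n) 1) =
      expAd der g u₁ - expAd der g u₂ + g * der (u₁ - u₂) := by
    have h := adMap_pow_one_sub der g u₁ u₂
    simp only [pow_one] at h
    simp [Finset.sum_range_succ, h]
  obtain ⟨k, hk, -, hle⟩ := hs.exists_val_le (Finset.range 2) (by rwa [hlow])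
  obtain ⟨n, rfl⟩ : ∃ n, k = n + 2 := ⟨k - 2, by simp at hk; omega⟩
  refine ⟨n, ?_⟩
  rw [hlow, ← smul_sub] at hle
  exact (val_le_smul _ _).trans hle

/-- `E` is linearized by `u ↦ 1 - g u′`. -/
theorem val_lt_expAd_sub [CharZero C]
    (hD : IsHDerivation der) (hreg : IsRegular der.toLinearMap) (hg : g ∈ Cont der)
    (hg0 : g ≠ 0) {d : D} (hgd : InStage d g) {u₁ u₂ : Lim C G}
    (h₁ : u₁ ∈ admissible der g d) (h₂ : u₂ ∈ admissible der g d) (hne : u₁ ≠ u₂) :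
    val (g * der (u₁ - u₂)) < val (expAd der g u₁ - expAd der g u₂ + g * der (u₁ - u₂)) := by
  obtain ⟨η, hη⟩ := exists_val_eq (sub_ne_zero.2 hne)
  have hη0 : η ≠ 0 := val_ne_zero_of_coeff
    (by rw [map_sub, HahnSeries.coeff_sub, h₁.2.1, h₂.2.1, sub_zero]) hη
  obtain ⟨β, hβ⟩ := exists_val_eq (mul_ne_zero hg0 (hD.der_ne_zero hη hη0))
  have hc₁ := hD.isContracting_adMap hg h₁.2.2
  have hc₂ := hD.isContracting_adMap hg h₂.2.2
  have key : ∀ n : ℕ, (β : WithTop Γ) ≤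
        val ((adMap der g u₁ ^ (n + 1)) 1 - (adMap der g u₂ ^ (n + 1)) 1) ∧
      (β : WithTop Γ) < val ((adMap der g u₁ ^ (n + 2)) 1 - (adMap der g u₂ ^ (n + 2)) 1) := by
    have step : ∀ n : ℕ, (β : WithTop Γ) ≤
        val ((adMap der g u₁ ^ (n + 1)) 1 - (adMap der g u₂ ^ (n + 1)) 1) →
      (β : WithTop Γ) < val ((adMap der g u₁ ^ (n + 2)) 1 - (adMap der g u₂ ^ (n + 2)) 1) := by
      intro n hn
      rw [adMap_pow_succ_sub der g u₁ u₂ (n + 1)]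
      refine lt_val_add (hc₁.lt_of_le hn) ?_
      rw [← hβ]
      exact hD.val_lt_val_adMap hg0 hη hη0 (hc₂.pow_lt (γ := 0) val_one.ge n.succ_ne_zero)
    intro n
    induction n with
    | zero =>
      have : (β : WithTop Γ) ≤
          val ((adMap der g u₁ ^ (0 + 1)) 1 - (adMap der g u₂ ^ (0 + 1)) 1) := by
        rw [zero_add, adMap_pow_one_sub, val_neg, hβ]
      exact ⟨this, step 0 this⟩
    | succ n ih => exact ⟨ih.2.le, step _ ih.2.le⟩
  by_cases h0 : expAd der g u₁ - expAd der g u₂ + g * der (u₁ - u₂) = 0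
  · rw [h0, val_zero, hβ]
    exact WithTop.coe_lt_top β
  · obtain ⟨n, hn⟩ := exists_val_le_expAd_sub hD hreg hg hgd h₁ h₂ h0
    rw [hβ]
    exact (key n).2.trans_le hn

theorem val_expAd_sub [CharZero C]
    (hD : IsHDerivation der) (hreg : IsRegular der.toLinearMap) (hg : g ∈ Cont der)
    (hg0 : g ≠ 0) {d : D} (hgd : InStage d g) {u₁ u₂ : Lim C G}
    (h₁ : u₁ ∈ admissible der g d) (h₂ : u₂ ∈ admissible der g d) :
    val (expAd der g u₁ - expAd der g u₂) = val (g * der (u₁ - u₂)) := by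
  rcases eq_or_ne u₁ u₂ with rfl | hne
  · simp
  · have := val_sub_eq_left (val_lt_expAd_sub hD hreg hg hg0 hgd h₁ h₂ hne)
    rw [← this, val_sub_comm]
    congr 1
    ring

theorem val_le_iff_val_mul_der_le [CharZero C]
    (hD : IsHDerivation der)
    (hg0 : g ≠ 0) {x y : Lim C G}
    (hx : (Lim.series x).coeff 0 = 0) (hy : (Lim.series y).coeff 0 = 0) :
    val x ≤ val y ↔ val (g * der x) ≤ val (g * der y) := by
  obtain ⟨γ, hγ⟩ := exists_val_eq hg0
  rcases eq_or_ne y 0 with rfl | hy0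
  · simp [val_zero]
  obtain ⟨β, hβ⟩ := exists_val_eq hy0
  have hβ0 := val_ne_zero_of_coeff hy hβ
  rw [val_mul, val_mul, hγ, hD.val_der hβ hβ0, hβ]
  rcases eq_or_ne x 0 with rfl | hx0
  · simp [val_zero]
  obtain ⟨α, hα⟩ := exists_val_eq hx0
  have hα0 := val_ne_zero_of_coeff hx hα
  rw [hD.val_der hα hα0, hα]
  norm_cast
  rw [add_le_add_iff_left]
  constructor
  · intro h
    rcases h.eq_or_lt with rfl | h
    · exact le_rfl
    · exact (hD.isHCouple.prime_lt_prime hα0 hβ0 h).le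
  · intro h
    by_contra! h'
    exact absurd (hD.isHCouple.prime_lt_prime hβ0 hα0 h') (not_lt.2 h)

theorem zero_mem_admissible
    (hD : IsHDerivation der)
    (d : D) : (0 : Lim C G) ∈ admissible der g d :=
  ⟨InStage.zero, by simp, by
    rw [hD.mem_cont_iff]
    simp [val_zero]⟩

/-- Nested balls with centres in `admissible der g d` have a common point there. -/
theorem exists_pseudoLimit_admissible
    (hD : IsHDerivation der)
    (d : D) (r : Lim C G → WithTop Γ)
    (h1 : ∀ a ∈ admissible der g d, ∀ b ∈ admissible der g d, min (r a) (r b) ≤ val (a - b))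
    (h2 : ∀ a ∈ admissible der g d, ∃ b ∈ admissible der g d, r a = val (b - a)) :
    ∃ x ∈ admissible der g d, ∀ a ∈ admissible der g d, r a ≤ val (x - a) := by
  have hr : ∀ a : Lim C G, Function.extend Lim.series r (fun _ => ⊤) (Lim.series a) = r a :=
    fun a => Lim.series_injective.extend_apply _ _ _
  obtain ⟨y, hyT, hy⟩ := exists_pseudoLimit (Γ := Γ) (A := C) ((G d : Set Γ) \ {0})
    (Lim.series '' admissible der g d) (by
      rintro _ ⟨a, ha, rfl⟩ γ hγ
      refine ⟨inStage_iff.1 ha.1 γ hγ, ?_⟩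
      rintro rfl
      exact hγ ha.2.1) (Function.extend Lim.series r fun _ => ⊤) (by
      rintro _ ⟨a, ha, rfl⟩ _ ⟨b, hb, rfl⟩
      rw [hr, hr, ← map_sub]
      exact h1 a ha b hb)
  obtain ⟨x, rfl, hx⟩ := exists_series_eq (C := C) (G := G) (d := d) (s := y)
    fun γ hγ => (hyT hγ).1
  have hxr : ∀ a ∈ admissible der g d, r a ≤ val (x - a) := fun a ha => by
    have := hy _ ⟨a, ha, rfl⟩
    rwa [hr, ← map_sub] at this
  refine ⟨x, ⟨hx, ?_, ?_⟩, hxr⟩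
  · by_contra h
    exact (hyT h).2 rfl
  · -- comparison with the centre `0`
    have h0 := zero_mem_admissible hD (g := g) d
    obtain ⟨b, hb, hrb⟩ := h2 0 h0
    have := hxr 0 h0
    rw [hrb, sub_zero, sub_zero] at this
    refine hD.mem_cont_of_min_le hb.2.2 hb.2.2 ?_
    rw [min_self, val_mul, val_mul]
    exact add_le_add_right this _

/-- Among the admissible elements of `𝕊_d`, some `u` brings `E(u)` closest to `F`. -/
theorem exists_max_val_sub_expAd [CharZero C]
    (hD : IsHDerivation der) (hreg : IsRegular der.toLinearMap) (hg : g ∈ Cont der)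
    (hg0 : g ≠ 0) {d : D} (hgd : InStage d g)
    (F : Lim C G) :
    ∃ u ∈ admissible der g d, ∀ u₁ ∈ admissible der g d,
      val (F - expAd der g u₁) ≤ val (F - expAd der g u) := by
  refine exists_max_val (val : Lim C G → WithTop Γ) (val : Lim C G → WithTop Γ) val_sub_comm
    val_neg min_val_le_add (admissible der g d) (fun u => F - expAd der g u) ?_
    (exists_pseudoLimit_admissible hD d)
  intro a ha b hb c hc
  have hco : ∀ a ∈ admissible der g d, (Lim.series (a - c)).coeff 0 = 0 := fun a ha => by
    rw [map_sub, HahnSeries.coeff_sub, ha.2.1, hc.2.1, sub_zero]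
  have hρ : ∀ a ∈ admissible der g d, val ((F - expAd der g a) - (F - expAd der g c)) =
      val (g * der (a - c)) := fun a ha => by
    rw [sub_sub_sub_cancel_left, val_sub_comm, val_expAd_sub hD hreg hg hg0 hgd ha hc]
  rw [hρ a ha, hρ b hb]
  exact val_le_iff_val_mul_der_le hD hg0 (hco a ha) (hco b hb)

end

end

section

variable {Γ : Type u} [AddCommGroup Γ] [LinearOrder Γ] [IsOrderedAddMonoid Γ]
variable {C : Type v} [Field C] {D : Type w} {G : D → AddSubgroup Γ}
variable {der : Derivation C (Lim C G) (Lim C G)} {f g : Lim C G}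

/-! ### Passing an exceptional valuation -/

/-- Let `s ∈ G d` not be of the form `γ′` with `γ ∈ G d`. Then elements of `𝕊_d` of valuation
greater than `v(g) + s` are deep, because `s` bounds `ψ` on `G d`. -/
theorem isDeep_of_inStage [CharZero C] (hD : IsHDerivation der) {d : D}
    (hψ : ∀ γ ∈ G d, γ ≠ 0 → psi der γ ∈ G d) {γ s : Γ} (hγ : γ ∈ G d) (hs : s ∈ G d)
    (hne : ∀ γ ∈ G d, γ ≠ 0 → γ + psi der γ ≠ s) {z : Lim C G} (hz : InStage d z)
    (hlt : ((γ + s : Γ) : WithTop Γ) < val z) : IsDeep der d γ z := by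
  intro hz0
  obtain ⟨β, hβ⟩ := exists_val_eq hz0
  rw [hβ] at hlt
  have hlt : γ + s < β := by exact_mod_cast hlt
  have hα : β - γ - s ∈ G d := (G d).sub_mem ((G d).sub_mem (hz.val_mem hβ) hγ) hs
  have h0 : 0 < β - γ - s := by grind
  have := hD.isHCouple.psi_le_of_forall_ne hψ hs hne h0 hα
  refine ⟨_, hα, h0, ?_⟩
  rw [hβ]
  norm_cast
  grind

theorem IsDeep.mono [Preorder D] (hG : Monotone G) {d e : D} (hde : d ≤ e) {γ : Γ}
    {z : Lim C G} (h : IsDeep der d γ z) : IsDeep der e γ z := fun hz =>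
  let ⟨α, h1, h2⟩ := h hz
  ⟨α, hG hde h1, h2⟩

/-- Brackets of infinitesimals of `𝕊_d` with a term `Δ` whose derivative has an exceptional
valuation `s` are deep: `v(Δ)` is negligible in comparison with the elements of `G d`. -/
theorem isDeep_adMap [CharZero C] [Preorder D] (hG : Monotone G) (hD : IsHDerivation der) {d e : D}
    (hde : d ≤ e) (hψ : ∀ γ ∈ G d, γ ≠ 0 → psi der γ ∈ G d) {γ η : Γ} (hgv : val g = γ)
    {Δ : Lim C G} (hΔ : val Δ = η) (hη : η ≠ 0) (hηe : η ∈ G e) (hs : η + psi der η ∈ G d)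
    (hne : ∀ α ∈ G d, α ≠ 0 → α + psi der α ≠ η + psi der η) {w : Lim C G} (hw : InStage d w)
    (hw0 : 0 < val w) : IsDeep der e γ (adMap der g Δ w) := by
  have hH := hD.isHCouple
  rcases eq_or_ne w 0 with rfl | hwne
  · rw [map_zero]
    exact fun h => absurd rfl h
  obtain ⟨α, hα⟩ := exists_val_eq hwne
  have hα0 : 0 < α := by rw [hα] at hw0; exact_mod_cast hw0
  have hαd := hw.val_mem hα
  have hle := hH.psi_le_of_forall_ne hψ hs hne hα0 hαd
  rw [adMap_apply]
  refine IsDeep.sub (fun _ => ?_) (fun _ => ?_)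
  -- the summand `g Δ w′`; if `v(Δ) < 0`, then `α + v(Δ)` has the same archimedean class as `α`
  · have hv : val (g * Δ * der w) = ((γ + η + (α + psi der α) : Γ) : WithTop Γ) := by
      rw [val_mul, val_mul, hgv, hΔ, hD.val_der hα hα0.ne', ← WithTop.coe_add, ← WithTop.coe_add]
    rw [hv]
    rcases lt_or_gt_of_ne hη with h | h
    · have h1 : -η + -η < α := by
        by_contra! h1
        have h2 := hH.anti _ _ hα0 h1
        rw [hH.double, hH.neg] at h2
        grind
      refine ⟨α + η, (G e).add_mem (hG hde hαd) hηe, by grind, ?_⟩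
      have h2 := hH.eq_of_le_double (α := α + η) (β := α) (by grind) (by grind) (by grind)
      norm_cast
      grind
    · refine ⟨α, hG hde hαd, hα0, ?_⟩
      norm_cast
      grind
  -- the summand `g Δ′ w`
  · refine ⟨α, hG hde hαd, hα0, ?_⟩
    rw [val_mul, val_mul, hgv, hD.val_der hΔ hη, hα]
    norm_cast
    grind

/-- Adding to `u ∈ 𝕊_d` a term `Δ` for which `Δ′` has an exceptional valuation changes `E(u)` by
`-g Δ′` up to a deep error. -/
theorem isDeep_expAd_sub [CharZero C] [Preorder D] (hG : Monotone G) (hD : IsHDerivation der)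
    (hreg : IsRegular der.toLinearMap) (hg : g ∈ Cont der) {d e : D} (hde : d ≤ e)
    (hgd : InStage d g) {γ η : Γ} (hgv : val g = γ) {u Δ : Lim C G}
    (hu : u ∈ admissible der g d) (hΔe : Δ ∈ admissible der g e) (hu₁ : u + Δ ∈ admissible der g e)
    (hΔ : val Δ = η) (hη : η ≠ 0) (hdΔ : InStage d (der Δ))
    (hne : ∀ α ∈ G d, α ≠ 0 → α + psi der α ≠ η + psi der η) :
    IsDeep der e γ (expAd der g (u + Δ) - expAd der g u + g * der Δ) := by
  have hψ : ∀ γ ∈ G d, γ ≠ 0 → psi der γ ∈ G d := fun γ => hD.psi_mem (hreg d).1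
  have hs : η + psi der η ∈ G d := hdΔ.val_mem (hD.val_der hΔ hη)
  have hηe : η ∈ G e := hΔe.1.val_mem hΔ
  have had : ∀ {w : Lim C G}, InStage d w → 0 < val w → IsDeep der e γ (adMap der g Δ w) :=
    fun hw hw0 => isDeep_adMap hG hD hde hψ hgv hΔ hη hηe hs hne hw hw0
  have hdiff : u + Δ - u = Δ := by ring
  have hc := hD.isContracting_adMap hg hu.2.2
  have hc₁ := hD.isContracting_adMap hg hu₁.2.2
  -- the terms of positive order of the series for `E(u)` are infinitesimals of `𝕊_d`
  have hw : ∀ n : ℕ, 0 < val ((adMap der g u ^ (n + 1)) 1) := fun n =>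
    hc.pow_lt (γ := 0) val_one.ge n.succ_ne_zero
  have key : ∀ n : ℕ,
      IsDeep der e γ ((adMap der g (u + Δ) ^ (n + 2)) 1 - (adMap der g u ^ (n + 2)) 1) := by
    intro n
    induction n with
    | zero =>
      have hgΔ : InStage d (g * der Δ) := hgd.mul hdΔ
      have hpos := hD.pos_val_mul_der hg hΔe.2.2
      have hsplit : adMap der g (u + Δ) (g * der Δ) =
          adMap der g u (g * der Δ) + adMap der g Δ (g * der Δ) := by
        have := adMap_sub_left der g (u + Δ) u (g * der Δ)
        rw [hdiff] at this
        rw [this]; ring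
      rw [adMap_pow_succ_sub der g (u + Δ) u (0 + 1), hdiff, zero_add, adMap_pow_one_sub, hdiff,
        map_neg, hsplit]
      refine IsDeep.add (IsDeep.add ?_ (had hgΔ hpos)).neg
        (had (inStage_adMap_pow_one hreg hgd hu _) (hw 0))
      refine IsDeep.mono hG hde (isDeep_of_inStage hD hψ (hgd.val_mem hgv) hs hne
        ((isStrongAt_adMap (hreg d) hgd hu.1).1 _ hgΔ) (hc.lt_of_le ?_))
      rw [val_mul, hgv, hD.val_der hΔ hη, ← WithTop.coe_add]
    | succ n ih =>
      rw [adMap_pow_succ_sub der g (u + Δ) u (n + 1 + 1), hdiff]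
      exact (ih.of_le (hc₁.le _)).add (had (inStage_adMap_pow_one hreg hgd hu _) (hw (n + 1)))
  intro h0
  rw [← hdiff] at h0
  obtain ⟨n, hn⟩ := exists_val_le_expAd_sub hD hreg hg (hgd.mono hG hde) hu₁
    (admissible_mono hG hde hu) (by rwa [hdiff] at h0 ⊢)
  rw [hdiff] at hn h0
  exact (key n).of_le hn h0

/-! ### Solving `E(u) = f / g` -/

/-- With asymptotic integration, there is no pseudo-gap. -/
theorem not_isPseudoGap (hD : IsHDerivation der) (hint : ClosedUnderAsympIntegration der) (γ : Γ) :
    ¬ IsPseudoGap der γ := by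
  obtain ⟨x, hx⟩ := hD.exists_val γ
  obtain ⟨A, hA⟩ := hint x (ne_zero_of_val hx)
  have hdA : val (der A) = γ := by
    have := val_sub_eq_left hA
    rwa [sub_sub_cancel, hx, eq_comm] at this
  rw [IsPseudoGap, not_not]
  have hdA0 := ne_zero_of_val hdA
  obtain ⟨α, hα⟩ := exists_val_eq (x := A) (by rintro rfl; simp at hdA0)
  rcases eq_or_ne α 0 with rfl | hα0
  · obtain ⟨δ, hδ, hv⟩ := hD.exists_der_eq hα.ge hdA0
    rw [hdA] at hv
    exact ⟨δ, (WithTop.coe_injective hv) ▸ hD.isPrimeValue hδ.ne'⟩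
  · exact ⟨α, hα0, A, hα, hdA⟩

/-- The hypothesis on `(f - g) / g²` keeps the corrections in the contractive hull. -/
theorem mem_cont_of_le [CharZero C] (hD : IsHDerivation der) (hg : g ∈ Cont der) {γ : Γ}
    (hgv : val g = γ)
    (hmu : ∀ ψ ∈ psiSet der, ∀ β : Γ,
      IsPrimeValue der (-(Lim.series g).order - ψ) β →
        (β : WithTop Γ) < val ((f - g) / g ^ 2))
    {η : Γ} (hη : η ≠ 0)
    (hle : val (f / g - 1) ≤ ((γ + (η + psi der η) : Γ) : WithTop Γ)) {Δ : Lim C G}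
    (hΔ : val Δ = η) : g * Δ ∈ Cont der := by
  have hH := hD.isHCouple
  have hg0 := ne_zero_of_val hgv
  rw [hD.mem_cont_iff_of_val (η := γ + η) (by rw [val_mul, hgv, hΔ, WithTop.coe_add])]
  have key : ∀ δ : Γ, 0 < δ → 0 < γ + η + psi der δ := by
    intro δ hδ
    have h1 := (hD.mem_cont_iff_of_val hgv).1 hg δ hδ.ne'
    have hne : -γ - psi der δ ≠ 0 := by grind
    have h2 := hmu _ (hD.psi_mem_psiSet hδ) _
      (by rw [order_series hgv]; exact hD.isPrimeValue hne)
    have h3 : f / g - 1 = g * ((f - g) / g ^ 2) := by field_simp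
    have h4 := (lt_val_mul hgv h2).trans_le (h3 ▸ hle)
    have h5 : -γ - psi der δ + psi der (-γ - psi der δ) < η + psi der η := by
      have : γ + (-γ - psi der δ + psi der (-γ - psi der δ)) < γ + (η + psi der η) := by
        exact_mod_cast h4
      grind
    by_contra! h6
    rcases (show η ≤ -γ - psi der δ by grind).eq_or_lt with h7 | h7
    · rw [← h7] at h5
      exact lt_irrefl _ h5
    · exact lt_irrefl _ (h5.trans (hH.prime_lt_prime hη hne h7))
  intro δ hδ
  rcases lt_or_gt_of_ne hδ with h | h
  · rw [← hH.neg]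
    exact key _ (by grind)
  · exact key _ h

theorem add_mem_admissible (hD : IsHDerivation der) {d : D} {u Δ : Lim C G}
    (hu : u ∈ admissible der g d) (hΔ : Δ ∈ admissible der g d) :
    u + Δ ∈ admissible der g d := by
  refine ⟨hu.1.add hΔ.1, by rw [map_add, HahnSeries.coeff_add, hu.2.1, hΔ.2.1, add_zero],
    hD.mem_cont_of_min_le hu.2.2 hΔ.2.2 ?_⟩
  rw [mul_add]
  exact min_val_le_add _ _

/-- If `u` brings `E(u)` as close as possible to `f / g` in `𝕊_d`, then the valuation of the
remainder is not of the form `v(g) + γ′` with `γ ∈ G d`. -/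
theorem prime_ne_of_max [CharZero C] (hD : IsHDerivation der) (hreg : IsRegular der.toLinearMap)
    (hg : g ∈ Cont der) {d : D} (hgd : InStage d g) {γ : Γ} (hgv : val g = γ)
    (hmu : ∀ ψ ∈ psiSet der, ∀ β : Γ,
      IsPrimeValue der (-(Lim.series g).order - ψ) β →
        (β : WithTop Γ) < val ((f - g) / g ^ 2))
    {u : Lim C G} (hu : u ∈ admissible der g d)
    (hmax : ∀ u₁ ∈ admissible der g d,
      val (f / g - expAd der g u₁) ≤ val (f / g - expAd der g u)) {s : Γ}
    (hs : val (f / g - expAd der g u) = ((γ + s : Γ) : WithTop Γ)) {η : Γ} (hηd : η ∈ G d)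
    (hη : η ≠ 0) : η + psi der η ≠ s := by
  rintro rfl
  have hg0 := ne_zero_of_val hgv
  obtain ⟨x, hxs, hxd, hx⟩ := exists_monomial (C := C) hηd
  have hv : ∀ {Δ : Lim C G}, val Δ = η →
      val (g * der Δ) = ((γ + (η + psi der η) : Γ) : WithTop Γ) := fun hΔ => by
    rw [val_mul, hgv, hD.val_der hΔ hη, ← WithTop.coe_add]
  obtain ⟨c, hc, hlt⟩ := exists_lt_val_sub_smul hs (hv hx)
  have hΔ : val (-(c • x)) = η := by rw [val_neg, val_smul hc, hx]
  have hΔm : -(c • x) ∈ admissible der g d := by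
    refine ⟨(hxd.smul c).neg, ?_, mem_cont_of_le hD hg hgv hmu hη ?_ hΔ⟩
    · rw [map_neg, map_smul, hxs, HahnSeries.coeff_neg, HahnSeries.coeff_smul,
        HahnSeries.coeff_single_of_ne hη.symm]
      simp
    · have := hmax 0 (zero_mem_admissible hD d)
      rwa [expAd_zero hD hreg hg hgd (zero_mem_admissible hD d), hs] at this
  have h₁ := add_mem_admissible hD hu hΔm
  refine absurd (hmax _ h₁) (not_le.2 ?_)
  have hdiff : u + -(c • x) - u = -(c • x) := by ring
  have h2 := val_lt_expAd_sub hD hreg hg hg0 hgd h₁ hu (by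
    intro h
    rw [h, sub_self] at hdiff
    exact ne_zero_of_val hΔ hdiff.symm)
  rw [hdiff, hv hΔ, ← hs] at h2
  have h3 : f / g - expAd der g (u + -(c • x)) =
      (f / g - expAd der g u - c • (g * der x)) -
        (expAd der g (u + -(c • x)) - expAd der g u + g * der (-(c • x))) := by
    rw [map_neg, Derivation.map_smul, mul_neg, mul_smul_comm]
    ring
  rw [h3]
  exact lt_val_sub hlt h2

/-- There is an admissible `u` with `exp (ad (u g ∂)) (g ∂) = f ∂`. The best approximation in `𝕊_d`
leaves a remainder of exceptional valuation; a term `τ` of a later stage `𝕊_e` removes its leading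
part, and then the best approximation in `𝕊_e` leaves no remainder. -/
theorem exists_expAd_eq [CharZero C] [Preorder D] [IsDirectedOrder D] [Nonempty D] (hG : Monotone G)
    (hD : IsHDerivation der) (hreg : IsRegular der.toLinearMap)
    (hint : HasRegularAsympIntegration der) (hg : g ∈ Cont der) (hg0 : g ≠ 0)
    (hmu : ∀ ψ ∈ psiSet der, ∀ β : Γ,
      IsPrimeValue der (-(Lim.series g).order - ψ) β →
        (β : WithTop Γ) < val ((f - g) / g ^ 2)) :
    ∃ d, InStage d g ∧ ∃ u ∈ admissible der g d, expAd der g u = f / g := by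
  obtain ⟨d, hfd, hgd⟩ := exists_inStage₂ hG f g
  obtain ⟨γ, hgv⟩ := exists_val_eq hg0
  have hγd := hgd.val_mem hgv
  have hFd : InStage d (f / g) := by
    rw [div_eq_mul_inv]
    exact hfd.mul hgd.inv
  obtain ⟨u, hu, hmax⟩ := exists_max_val_sub_expAd hD hreg hg hg0 hgd (f / g)
  by_cases hρ0 : f / g - expAd der g u = 0
  · exact ⟨d, hgd, u, hu, (sub_eq_zero.1 hρ0).symm⟩
  have hρd : InStage d (f / g - expAd der g u) := hFd.sub (inStage_expAd hD hreg hg hgd hu)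
  obtain ⟨β, hβ⟩ := exists_val_eq hρ0
  obtain ⟨s, rfl⟩ : ∃ s, β = γ + s := ⟨β - γ, by grind⟩
  have hsd : s ∈ G d := by simpa using (G d).sub_mem (hρd.val_mem hβ) hγd
  have hne : ∀ α ∈ G d, α ≠ 0 → α + psi der α ≠ s := fun α hα hα0 =>
    prime_ne_of_max hD hreg hg hgd hgv hmu hu hmax hβ hα hα0
  -- a term `τ` with `g τ′ ∼ -(f / g - E(u))`
  obtain ⟨e, hde, hterm⟩ := hint.2 d
  have hz : val (-(f / g - expAd der g u) / g) = s := by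
    rw [val_div (γ := γ + s) (by rw [val_neg, hβ]) hgv]
    norm_cast
    grind
  obtain ⟨τ, ⟨η, hηe, c, hτ⟩, hsim, hdτ⟩ := hterm _ (ne_zero_of_val hz)
    (by rw [div_eq_mul_inv]; exact hρd.neg.mul hgd.inv)
    (fun α _ => not_isPseudoGap hD hint.1 α)
  have hdv : val (der τ) = s := by
    have := val_sub_eq_left hsim
    rwa [sub_sub_cancel, hz, eq_comm] at this
  have hc : c ≠ 0 := by
    rintro rfl
    rw [HahnSeries.single_eq_zero, map_eq_zero_iff _ Lim.series_injective] at hτ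
    rw [hτ, map_zero, val_zero] at hdv
    exact WithTop.top_ne_coe hdv
  have hη : η ≠ 0 := by
    rintro rfl
    rw [← series_algebraMap (G := G)] at hτ
    rw [Lim.series_injective hτ, Derivation.map_algebraMap, val_zero] at hdv
    exact WithTop.top_ne_coe hdv
  have hτv : val τ = η := by rw [val, hτ, HahnSeries.orderTop_single hc]
  obtain rfl : η + psi der η = s := by
    rw [hD.val_der hτv hη] at hdv
    exact_mod_cast hdv
  have hτm : τ ∈ admissible der g e := by
    refine ⟨inStage_iff.2 fun α hα => ?_, ?_, mem_cont_of_le hD hg hgv hmu hη ?_ hτv⟩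
    · by_cases h : α = η
      · exact h ▸ hηe
      · rw [hτ, HahnSeries.coeff_single_of_ne h] at hα
        exact absurd rfl hα
    · rw [hτ, HahnSeries.coeff_single_of_ne hη.symm]
    · have := hmax 0 (zero_mem_admissible hD d)
      rwa [expAd_zero hD hreg hg hgd (zero_mem_admissible hD d), hβ] at this
  have hu₁ := add_mem_admissible hD (admissible_mono hG hde hu) hτm
  have hψd : ∀ γ ∈ G d, γ ≠ 0 → psi der γ ∈ G d := fun γ => hD.psi_mem (hreg d).1
  have hψe : ∀ γ ∈ G e, γ ≠ 0 → psi der γ ∈ G e := fun γ => hD.psi_mem (hreg e).1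
  have hdeep : IsDeep der e γ (f / g - expAd der g (u + τ)) := by
    have h1 : f / g - expAd der g (u + τ) = (f / g - expAd der g u + g * der τ) -
        (expAd der g (u + τ) - expAd der g u + g * der τ) := by ring
    rw [h1]
    refine IsDeep.sub (IsDeep.mono hG hde (isDeep_of_inStage hD hψd hγd hsd hne
      (hρd.add (hgd.mul hdτ)) ?_))
      (isDeep_expAd_sub hG hD hreg hg hde hgd hgv hu hτm hu₁ hτv hη hdτ hne)
    have h2 : f / g - expAd der g u + g * der τ =
        g * (der τ - -(f / g - expAd der g u) / g) := by
      rw [mul_sub, mul_div_cancel₀ _ hg0]; ring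
    rw [h2]
    refine lt_val_mul hgv ?_
    rwa [Sim, hdv] at hsim
  -- the best approximation in `𝕊_e` has a deep remainder as well, which could be improved
  have hge := hgd.mono hG hde
  obtain ⟨u', hu', hmax'⟩ := exists_max_val_sub_expAd hD hreg hg hg0 hge (f / g)
  refine ⟨e, hge, u', hu', ?_⟩
  by_contra h0
  have h0' : f / g - expAd der g u' ≠ 0 := fun h => h0 (sub_eq_zero.1 h).symm
  obtain ⟨β', hβ'⟩ := exists_val_eq h0'
  obtain ⟨s', rfl⟩ : ∃ s, β' = γ + s := ⟨β' - γ, by grind⟩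
  have hρe : InStage e (f / g - expAd der g u') :=
    (hFd.mono hG hde).sub (inStage_expAd hD hreg hg hge hu')
  have hse : s' ∈ G e := by simpa using (G e).sub_mem (hρe.val_mem hβ') (hG hde hγd)
  obtain ⟨α, hαe, hα0, hα⟩ := hdeep.of_le (hmax' _ hu₁) h0'
  rw [hβ'] at hα
  have hα' : α + psi der α ≤ s' := by
    have : γ + (α + psi der α) ≤ γ + s' := by exact_mod_cast hα
    grind
  obtain ⟨δ, hδe, hδ0, hδ⟩ := hD.isHCouple.exists_prime_eq_of_le hψe hα0 hαe hse hα'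
  exact prime_ne_of_max hD hreg hg hge hgv hmu hu' hmax' hβ' hδe hδ0.ne' hδ

end

section

variable {Γ : Type u} [AddCommGroup Γ] [LinearOrder Γ] [IsOrderedAddMonoid Γ]
variable {C : Type v} [Field C] {D : Type w} {G : D → AddSubgroup Γ}

/-! ### The automorphism `exp (h ∂)` -/

/-- Strong linearity for families indexed by `ℕ`, in whatever universe `Γ` lives. -/
theorem IsStrongAt.hasStrongSum_nat {d : D} {φ : Lim C G →ₗ[C] Lim C G} (h : IsStrongAt d φ)
    {F : ℕ → Lim C G} {x : Lim C G} (hF : ∀ n, InStage d (F n)) (hx : HasStrongSum F x) :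
    HasStrongSum (fun n => φ (F n)) (φ x) :=
  (h.2 (ULift.{u} ℕ) _ x (fun n => hF n.down) (hx.comp_equiv Equiv.ulift)).comp_equiv
    Equiv.ulift.symm

theorem isStronglyLinear_of_isStrongAt [Preorder D] [IsDirectedOrder D] (hG : Monotone G)
    {φ : Lim C G →ₗ[C] Lim C G} (d : D) (h : ∀ e, d ≤ e → IsStrongAt e φ) :
    IsStronglyLinear φ := by
  intro ι F x hx
  obtain ⟨e, he⟩ := hx.1
  obtain ⟨e', hde, hee⟩ := exists_ge_ge d e
  exact (h e' hde).2 ι F x (fun i => (he i).mono hG hee) hx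

variable {der : Derivation C (Lim C G) (Lim C G)}

theorem isStrongAt_smul_der (hreg : IsRegular der.toLinearMap) {d : D} {h : Lim C G}
    (hd : InStage d h) : IsStrongAt d (h • der).toLinearMap :=
  (IsStrongAt.mulLeft hd).mul (hreg d)

theorem IsExp.map_mul [CharZero C] [Preorder D] [IsDirectedOrder D] (hG : Monotone G)
    {h : Lim C G} {σ : Lim C G →ₗ[C] Lim C G} (hσ : IsExp (h • der).toLinearMap σ)
    (x y : Lim C G) : σ (x * y) = σ x * σ y := by
  refine (hσ (x * y)).unique ?_
  convert ((hσ x).mul hG (hσ y)).sum_antidiagonal using 2 with n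
  refine inv_factorial_smul_pow_bilin (LinearMap.mul C (Lim C G)) _ _ _ (fun a b => ?_) n x y
  simp only [LinearMap.mul_apply', Derivation.coeFn_coe, Derivation.coe_smul,
    Pi.smul_apply,
    Derivation.leibniz, smul_eq_mul]
  ring

/-- The conjugation formula `σ ∘ (g ∂) = E(u) (g ∂) ∘ σ` for `σ = exp (u g ∂)`. -/
theorem IsExp.map_mul_der [CharZero C] [Preorder D] [IsDirectedOrder D] [Nonempty D]
    (hG : Monotone G) (hD : IsHDerivation der) (hreg : IsRegular der.toLinearMap) {g : Lim C G}
    (hg : g ∈ Cont der) {d : D} (hgd : InStage d g) {u : Lim C G} (hu : u ∈ admissible der g d)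
    {σ : Lim C G →ₗ[C] Lim C G} (hσ : IsExp ((g * u) • der).toLinearMap σ) (x : Lim C G) :
    σ (g * der x) = expAd der g u * (g * der (σ x)) := by
  obtain ⟨e, he⟩ := (hσ x).1
  obtain ⟨e', hge, hee⟩ := exists_ge_ge d e
  have hx := (isStrongAt_smul_der hreg (hgd.mono hG hge)).hasStrongSum_nat
    (fun n => (he n).mono hG hee) (hσ x)
  refine (hσ (g * der x)).unique ?_
  convert ((hasStrongSum_expAd hD hreg hg hgd hu).mul hG hx).sum_antidiagonal using 2 with n
  swap
  · rfl
  have := inv_factorial_smul_pow_bilin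
    ((LinearMap.mul C (Lim C G)).compl₂ (g • der).toLinearMap) (adMap der g u)
    ((g * u) • der).toLinearMap ((g * u) • der).toLinearMap (fun a b => ?_) n 1 x
  · simpa using this
  · simp only [LinearMap.compl₂_apply, LinearMap.mul_apply', Derivation.coeFn_coe,
      Derivation.coe_smul, Pi.smul_apply, adMap_apply, Derivation.leibniz, smul_eq_mul]
    ring

/-- Exponentials of contracting multiples of a regular derivation are strongly linear automorphisms
with strongly linear inverse. -/
theorem exists_exp_algEquiv [CharZero C] [Preorder D] [IsDirectedOrder D] [Nonempty D]
    (hG : Monotone G) (hreg : IsRegular der.toLinearMap) {h : Lim C G} (hc : h ∈ Cont der) :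
    ∃ σ : Lim C G ≃ₐ[C] Lim C G, IsExp (h • der).toLinearMap σ.toLinearMap ∧
      IsStronglyLinear σ.toLinearMap ∧ IsStronglyLinear σ.symm.toLinearMap := by
  obtain ⟨d, hd⟩ := exists_inStage hG h
  have hst : ∀ e, d ≤ e → IsStrongAt e (h • der).toLinearMap := fun e he =>
    isStrongAt_smul_der hreg (hd.mono hG he)
  have hcommon : ∀ x : Lim C G, ∃ e, d ≤ e ∧ InStage e x := fun x => by
    obtain ⟨e, he⟩ := exists_inStage hG x
    obtain ⟨e', hde, hee⟩ := exists_ge_ge d e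
    exact ⟨e', hde, he.mono hG hee⟩
  have hex : ∀ x, ∃ y, HasStrongSum
      (fun n : ℕ => ((n.factorial : C)⁻¹) • ((h • der).toLinearMap ^ n) x) y := fun x => by
    obtain ⟨e, hde, he⟩ := hcommon x
    exact IsContracting.exists_hasStrongSum (hst e hde) hc he
  have hσ := isExp_expMap (h • der).toLinearMap hex
  set s := expMap (h • der).toLinearMap hex
  have hinj : Function.Injective s := hσ.injective hc
  have hsurj : Function.Surjective s := fun x => by
    obtain ⟨e, hde, he⟩ := hcommon x
    obtain ⟨Y, -, hY⟩ := hσ.exists_preimage_family (hst e hde) hc (SummableAt.of_inStage he)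
    exact ⟨Y PUnit.unit, hY _⟩
  have hmul := hσ.map_mul hG
  have hone : s 1 = 1 := by
    have h1 : s 1 * s 1 = s 1 * 1 := by rw [← hmul, mul_one, mul_one]
    exact mul_left_cancel₀ ((map_ne_zero_iff s hinj).2 one_ne_zero) h1
  have hs : IsStronglyLinear s := isStronglyLinear_of_isStrongAt hG d fun e he =>
    hσ.isStrongAt (hst e he) hc
  let σ : Lim C G ≃ₐ[C] Lim C G :=
    AlgEquiv.ofBijective (AlgHom.ofLinearMap s hone hmul) ⟨hinj, hsurj⟩
  have hσs : ∀ x, σ x = s x := fun x => rfl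
  refine ⟨σ, hσ, hs, fun ι F x hx => ?_⟩
  obtain ⟨e, he⟩ := hx.1
  obtain ⟨e', hde, hee⟩ := exists_ge_ge d e
  obtain ⟨Y, ⟨hYd, y, hy⟩, hY⟩ := hσ.exists_preimage_family (hst e' hde) hc
    (F := F) ⟨fun i => (he i).mono hG hee, x, hx⟩
  have h1 := hs ι Y y hy
  simp only [hY] at h1
  have h2 : σ.symm.toLinearMap x = y := by
    rw [h1.unique hx |>.symm, ← hσs]
    exact σ.symm_apply_apply y
  have h3 : (fun i => σ.symm.toLinearMap (F i)) = Y := funext fun i => by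
    rw [← hY, ← hσs]
    exact σ.symm_apply_apply (Y i)
  rw [h2, h3]
  exact hy

end

end HahnConj

theorem mainTheorem2
    {C : Type*} [Field C] [CharZero C]
    {Γ : Type*} [AddCommGroup Γ] [LinearOrder Γ] [IsOrderedAddMonoid Γ]
    {D : Type*} [Preorder D] [IsDirectedOrder D] [Nonempty D]
    -- the directed system of nontrivial ordered groups, with direct limit `Γ`
    (G : D → AddSubgroup Γ) (hmono : Monotone G) (hnontrivial : ∀ d, G d ≠ ⊥)
    (hunion : ∀ γ : Γ, ∃ d, γ ∈ G d)
    -- the regular derivation `∂`, with kernel `C`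
    (der : Derivation C (HahnConj.Lim C G) (HahnConj.Lim C G))
    (hreg : HahnConj.IsRegular der.toLinearMap)
    (hker : ∀ x, der x = 0 ↔ ∃ c : C, x = algebraMap C (HahnConj.Lim C G) c)
    (hH : HahnConj.IsHAsymptotic der)
    (hint : HahnConj.HasRegularAsympIntegration der)
    (f g : HahnConj.Lim C G)
    (hf : f ∈ HahnConj.Cont der) (hg : g ∈ HahnConj.Cont der) (hf0 : f ≠ 0) (hg0 : g ≠ 0)
    -- `f ∼ g` and `v((f - g) / g²) > (-v(g) - Ψ)′`
    (hfg : HahnConj.Sim f g)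
    (hmu : ∀ ψ ∈ HahnConj.psiSet der, ∀ β : Γ,
      HahnConj.IsPrimeValue der (-(HahnConj.Lim.series g).order - ψ) β →
        (β : WithTop Γ) < HahnConj.val ((f - g) / g ^ 2)) :
    ∃ h ∈ HahnConj.Cont der,
      ∃ σ : HahnConj.Lim C G ≃ₐ[C] HahnConj.Lim C G,
        HahnConj.IsExp (h • der).toLinearMap σ.toLinearMap ∧
        HahnConj.IsStronglyLinear σ.toLinearMap ∧
        HahnConj.IsStronglyLinear σ.symm.toLinearMap ∧
        ∀ x, σ ((g • der) (σ.symm x)) = (f • der) x := by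
  have hD : HahnConj.IsHDerivation der := ⟨hunion, hker, hH⟩
  obtain ⟨d, hgd, u, hu, hE⟩ := HahnConj.exists_expAd_eq hmono hD hreg hint hg hg0 hmu
  obtain ⟨σ, hσ, hs, hs'⟩ := HahnConj.exists_exp_algEquiv hmono hreg hu.2.2
  refine ⟨g * u, hu.2.2, σ, hσ, hs, hs', fun x => ?_⟩
  have h := hσ.map_mul_der hmono hD hreg hg hgd hu (σ.symm x)
  rw [hE, ← mul_assoc, div_mul_cancel₀ f hg0] at h
  simpa using h
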